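/- Let $\Gamma$ be a finite abelian group, and let $R=\bigoplus_{\gamma\in\Gamma}R_\gamma$ be an associative unital ring graded over $\Gamma$ (that is, $R_\gamma R_{\delta}\subseteq R_{\gamma+\delta}$ for all $\gamma,\delta\in\Gamma$). Let $\mathsf{Mod}\,R$ be the category of right $R$-modules, and let $\mathsf{GrMod}\,R$ be the category of graded right $R$-modules $M=\bigoplus_{\gamma\in\Gamma}M_\gamma$ (with $M_\gamma R_\delta\subseteq M_{\gamma+\delta}$), whose morphisms are the $R$-linear maps $f\colon M\to N$ with $f(M_\gamma)\subseteq N_\gamma$ for all $\gamma\in\Gamma$. A localizing subcategory of a triangulated category is a (full, isomorphism-closed) triangulated subcategory that is closed under set-indexed coproducts. We say that injectives generate for $R$ if the smallest localizing subcategory of the derived category $\mathsf{D}(\mathsf{Mod}\,R)$ that contains all injective right $R$-modules (viewed as complexes concentrated in degree $0$) is the whole of $\mathsf{D}(\mathsf{Mod}\,R)$. We say that graded injectives generate for $R$ if the smallest localizing subcategory of $\mathsf{D}(\mathsf{GrMod}\,R)$ that contains all injective objects of $\mathsf{GrMod}\,R$ (viewed as complexes concentrated in degree $0$) is the whole of $\mathsf{D}(\mathsf{GrMod}\,R)$.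 Then graded injectives generate for $R$ if and only if injectives generate for $R$. -/

import Mathlib

open CategoryTheory Limits Pretriangulated

universe w' w v u

/-! ### Localizing subcategories -/

section Localizing

variable {T : Type u} [Category.{v} T] [HasZeroObject T] [HasShift T ℤ] [Preadditive T]
  [∀ n : ℤ, (shiftFunctor T n).Additive] [Pretriangulated T]

/-- A localizing subcategory of a triangulated category, given by its class of objects: a (full,
replete) triangulated subcategory which is closed under coproducts indexed by sets
(that is, by types in the universe `w`). -/
structure IsLocalizing (P : ObjectProperty T) : Prop where
  isTriangulated : P.IsTriangulated
  isClosedUnderIsomorphisms : P.IsClosedUnderIsomorphisms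
  isClosedUnderCoproducts : ∀ ι : Type w, P.IsClosedUnderColimitsOfShape (Discrete ι)

/-- `Loc S`: the smallest localizing subcategory containing the class of objects `S`, that is, the
intersection of all localizing subcategories containing `S`. -/
def Loc (S : ObjectProperty T) : ObjectProperty T :=
  fun X => ∀ P : ObjectProperty T, IsLocalizing.{w} P → S ≤ P → P X

theorem le_Loc (S : ObjectProperty T) : S ≤ Loc.{w} S :=
  fun _ hX _ _ hS => hS _ hX

theorem Loc_le {S P : ObjectProperty T} (hP : IsLocalizing.{w} P) (hS : S ≤ P) : Loc.{w} S ≤ P :=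
  fun _ hX => hX P hP hS

theorem isLocalizing_Loc (S : ObjectProperty T) : IsLocalizing.{w} (Loc.{w} S) := by
  have hiso : (Loc.{w} S).IsClosedUnderIsomorphisms :=
    ⟨fun e hX P hP hS => by
      have := hP.isClosedUnderIsomorphisms
      exact P.prop_of_iso e (hX P hP hS)⟩
  refine ⟨?_, hiso, fun ι => ⟨?_⟩⟩
  · have h0 : (Loc.{w} S).ContainsZero := ⟨⟨_, isZero_zero T, fun P hP hS => by
      have := hP.isClosedUnderIsomorphisms
      have := hP.isTriangulated
      obtain ⟨Z, hZ, hPZ⟩ := P.exists_prop_of_containsZero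
      exact P.prop_of_iso (hZ.iso (isZero_zero T)) hPZ⟩⟩
    have h1 : (Loc.{w} S).IsStableUnderShift ℤ := ⟨fun n => ⟨fun X hX P hP hS => by
      have := hP.isTriangulated
      exact P.le_shift n _ (hX P hP hS)⟩⟩
    have h2 : (Loc.{w} S).IsTriangulatedClosed₂ :=
      ObjectProperty.IsTriangulatedClosed₂.mk' fun t ht hX hZ P hP hS => by
        have := hP.isClosedUnderIsomorphisms
        have := hP.isTriangulated
        exact P.ext_of_isTriangulatedClosed₂ t ht (hX P hP hS) (hZ P hP hS)
    exact { }
  · rintro X ⟨h⟩ P hP hS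
    have := hP.isClosedUnderCoproducts ι
    exact P.prop_of_isColimit h.isColimit fun j => h.prop_diag_obj j P hP hS

end Localizing

/-- The objects of `C` satisfying `P`, viewed as complexes concentrated in degree `0`, as a class of
objects of the derived category of `C`. -/
def inDegreeZero {C : Type u} [Category.{v} C] [Abelian C] [HasDerivedCategory.{w'} C]
    (P : ObjectProperty C) : ObjectProperty (DerivedCategory C) :=
  fun X => ∃ I : C, P I ∧ X = (DerivedCategory.singleFunctor C 0).obj I

/-! ### Graded modules -/

/-- A right `R`-module (that is, an `Rᵐᵒᵖ`-module) together with a decomposition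
`M = ⨁ γ, M_γ` into additive subgroups with `M_γ · R_δ ⊆ M_{γ + δ}`, where `𝓡` is a grading
of the ring `R` by `Γ`. -/
structure GrMod {Γ : Type w} [AddCommGroup Γ] [DecidableEq Γ] {R : Type u} [Ring R]
    (𝓡 : Γ → AddSubgroup R) where
  /-- The underlying right module. -/
  toMod : ModuleCat.{v} Rᵐᵒᵖ
  /-- The homogeneous components. -/
  gr : Γ → AddSubgroup toMod
  isInternal : DirectSum.IsInternal gr
  smul_mem : ∀ {γ δ : Γ} {m : toMod} {r : R}, m ∈ gr γ → r ∈ 𝓡 δ →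
    MulOpposite.op r • m ∈ gr (γ + δ)

namespace GrMod

section Internal

variable {Γ : Type w} [DecidableEq Γ] {M : Type v} [AddCommGroup M]

/-- The projections attached to an internal direct sum decomposition. -/
noncomputable def projOf {gr : Γ → AddSubgroup M} (h : DirectSum.IsInternal gr) (γ : Γ) : M →+ M :=
  ((gr γ).subtype.comp (DFinsupp.evalAddMonoidHom γ)).comp
    (AddEquiv.ofBijective (DirectSum.coeAddMonoidHom gr) h).symm.toAddMonoidHom

variable {gr : Γ → AddSubgroup M} (h : DirectSum.IsInternal gr)

theorem projOf_coe (γ : Γ) (x : DirectSum Γ fun i => gr i) :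
    projOf h γ (DirectSum.coeAddMonoidHom gr x) = x γ := by
  have : (AddEquiv.ofBijective (DirectSum.coeAddMonoidHom gr) h).symm
      (DirectSum.coeAddMonoidHom gr x) = x :=
    (AddEquiv.ofBijective (DirectSum.coeAddMonoidHom gr) h).symm_apply_apply x
  change (((AddEquiv.ofBijective (DirectSum.coeAddMonoidHom gr) h).symm
      (DirectSum.coeAddMonoidHom gr x)) γ : M) = x γ
  rw [this]

theorem projOf_mem (γ : Γ) (m : M) : projOf h γ m ∈ gr γ := by
  obtain ⟨x, rfl⟩ := h.2 m
  rw [projOf_coe]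
  exact (x γ).2

theorem projOf_same {γ : Γ} {m : M} (hm : m ∈ gr γ) : projOf h γ m = m := by
  have := projOf_coe h γ (DirectSum.of (fun i => gr i) γ ⟨m, hm⟩)
  rwa [DirectSum.coeAddMonoidHom_of, DirectSum.of_eq_same] at this

theorem projOf_ne {γ δ : Γ} (hne : γ ≠ δ) {m : M} (hm : m ∈ gr γ) : projOf h δ m = 0 := by
  have := projOf_coe h δ (DirectSum.of (fun i => gr i) γ ⟨m, hm⟩)
  rwa [DirectSum.coeAddMonoidHom_of, DirectSum.of_eq_of_ne _ _ _ hne.symm] at this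

theorem exists_sum_projOf (m : M) : ∃ s : Finset Γ, m = ∑ γ ∈ s, projOf h γ m := by
  classical
  obtain ⟨x, rfl⟩ := h.2 m
  refine ⟨DFinsupp.support x, ?_⟩
  simp only [projOf_coe]
  exact DirectSum.coeAddMonoidHom_eq_dfinsuppSum _ x

/-- A family of additive subgroups with compatible projections is a decomposition. -/
theorem isInternal_of_proj {gr : Γ → AddSubgroup M} (p : Γ → M →+ M)
    (h1 : ∀ γ, ∀ m ∈ gr γ, p γ m = m) (h2 : ∀ γ δ, γ ≠ δ → ∀ m ∈ gr γ, p δ m = 0)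
    (h3 : ∀ γ m, p γ m ∈ gr γ)
    (h4 : ∀ m, ∃ s : Finset Γ, m = ∑ γ ∈ s, p γ m) : DirectSum.IsInternal gr := by
  have key : ∀ (γ : Γ) (x : DirectSum Γ fun i => gr i),
      p γ (DirectSum.coeAddMonoidHom gr x) = x γ := by
    intro γ x
    induction x using DirectSum.induction_on with
    | zero => simp
    | of i y =>
      rw [DirectSum.coeAddMonoidHom_of]
      by_cases hi : i = γ
      · subst hi
        rw [h1 _ _ y.2, DirectSum.of_eq_same]
      · rw [h2 _ _ hi _ y.2, DirectSum.of_eq_of_ne _ _ _ (Ne.symm hi)]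
        rfl
    | add x y hx hy => rw [map_add, map_add, hx, hy]; rfl
  constructor
  · rw [injective_iff_map_eq_zero]
    intro x hx
    refine DFinsupp.ext fun γ => Subtype.ext ?_
    have := key γ x
    rw [hx, map_zero] at this
    exact this.symm
  · intro m
    obtain ⟨s, hs⟩ := h4 m
    refine ⟨∑ γ ∈ s, DirectSum.of (fun i => gr i) γ ⟨p γ m, h3 γ m⟩, ?_⟩
    rw [map_sum]
    simp only [DirectSum.coeAddMonoidHom_of]
    exact hs.symm

end Internal

variable {Γ : Type w} [AddCommGroup Γ] [DecidableEq Γ] {R : Type u} [Ring R]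
  {𝓡 : Γ → AddSubgroup R}

/-- A homomorphism of graded modules is a module homomorphism `f : M ⟶ N` with
`f (M_γ) ⊆ N_γ` for all `γ`. -/
@[ext]
structure Hom (M N : GrMod.{w, v, u} 𝓡) where
  /-- The underlying module homomorphism. -/
  hom : M.toMod ⟶ N.toMod
  map_mem : ∀ {γ : Γ} {m : M.toMod}, m ∈ M.gr γ → hom m ∈ N.gr γ

/-- The category of graded right `R`-modules. -/
instance : Category.{v} (GrMod.{w, v, u} 𝓡) where
  Hom M N := Hom M N
  id M := ⟨𝟙 _, fun h => h⟩
  comp f g := ⟨f.hom ≫ g.hom, fun h => g.map_mem (f.map_mem h)⟩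

variable {M N K : GrMod.{w, v, u} 𝓡}

@[ext]
theorem hom_ext {f g : M ⟶ N} (h : f.hom = g.hom) : f = g := Hom.ext h

@[simp] theorem id_hom : (𝟙 M : M ⟶ M).hom = 𝟙 _ := rfl

@[simp] theorem comp_hom (f : M ⟶ N) (g : N ⟶ K) : (f ≫ g).hom = f.hom ≫ g.hom := rfl

instance : Zero (M ⟶ N) := ⟨⟨0, fun _ => (N.gr _).zero_mem⟩⟩

instance : Add (M ⟶ N) :=
  ⟨fun f g => ⟨f.hom + g.hom, fun h => (N.gr _).add_mem (f.map_mem h) (g.map_mem h)⟩⟩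

instance : Neg (M ⟶ N) := ⟨fun f => ⟨-f.hom, fun h => (N.gr _).neg_mem (f.map_mem h)⟩⟩

instance : Sub (M ⟶ N) :=
  ⟨fun f g => ⟨f.hom - g.hom, fun h => (N.gr _).sub_mem (f.map_mem h) (g.map_mem h)⟩⟩

instance : SMul ℕ (M ⟶ N) :=
  ⟨fun n f => ⟨n • f.hom, fun h => (N.gr _).nsmul_mem (f.map_mem h) n⟩⟩

instance : SMul ℤ (M ⟶ N) :=
  ⟨fun n f => ⟨n • f.hom, fun h => (N.gr _).zsmul_mem (f.map_mem h) n⟩⟩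

@[simp] theorem zero_hom : (0 : M ⟶ N).hom = 0 := rfl

@[simp] theorem add_hom (f g : M ⟶ N) : (f + g).hom = f.hom + g.hom := rfl

theorem hom_injective : Function.Injective (fun f : M ⟶ N => f.hom) := fun _ _ h => hom_ext h

instance : AddCommGroup (M ⟶ N) :=
  hom_injective.addCommGroup _ rfl (fun _ _ => rfl) (fun _ => rfl) (fun _ _ => rfl)
    (fun _ _ => rfl) (fun _ _ => rfl)

instance : Preadditive (GrMod.{w, v, u} 𝓡) where
  add_comp _ _ _ _ _ _ := by ext1; simp
  comp_add _ _ _ _ _ _ := by ext1; simp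

/-- The projection of a graded module onto its component of degree `γ`. -/
noncomputable abbrev proj (M : GrMod.{w, v, u} 𝓡) (γ : Γ) : M.toMod →+ M.toMod :=
  projOf M.isInternal γ

theorem hom_proj (f : M ⟶ N) (γ : Γ) (m : M.toMod) :
    f.hom (M.proj γ m) = N.proj γ (f.hom m) := by
  obtain ⟨s, hs⟩ := exists_sum_projOf M.isInternal m
  have key : ∀ δ, f.hom (M.proj γ (M.proj δ m)) = N.proj γ (f.hom (M.proj δ m)) := by
    intro δ
    have hm : M.proj δ m ∈ M.gr δ := projOf_mem _ _ _
    by_cases h : δ = γ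
    · subst h
      rw [projOf_same _ hm, projOf_same _ (f.map_mem hm)]
    · rw [projOf_ne _ h hm, projOf_ne _ h (f.map_mem hm), map_zero]
  rw [hs]
  simp only [map_sum]
  exact Finset.sum_congr rfl fun δ _ => key δ

theorem mem_of_injective (f : M ⟶ N) (hf : Function.Injective f.hom) {γ : Γ} {m : M.toMod}
    (h : f.hom m ∈ N.gr γ) : m ∈ M.gr γ := by
  have : M.proj γ m = m := hf (by rw [hom_proj, projOf_same _ h])
  rw [← this]
  exact projOf_mem _ _ _

theorem exists_lift_of_mem (f : M ⟶ N) {γ : Γ} {m : M.toMod} (h : f.hom m ∈ N.gr γ) :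
    ∃ m' ∈ M.gr γ, f.hom m' = f.hom m :=
  ⟨M.proj γ m, projOf_mem _ _ _, by rw [hom_proj, projOf_same _ h]⟩

/-- The kernel of a homomorphism of graded modules, with the induced grading. -/
noncomputable def kerObj (f : M ⟶ N) : GrMod.{w, v, u} 𝓡 where
  toMod := ModuleCat.of Rᵐᵒᵖ (LinearMap.ker f.hom.hom)
  gr γ := (M.gr γ).comap (LinearMap.ker f.hom.hom).subtype.toAddMonoidHom
  isInternal := by
    have hk : ∀ (γ : Γ) (x : LinearMap.ker f.hom.hom),
        M.proj γ x.1 ∈ (LinearMap.ker f.hom.hom).toAddSubgroup := by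
      intro γ x
      have hx : f.hom x.1 = 0 := x.2
      change f.hom (M.proj γ x.1) = 0
      rw [hom_proj, hx, map_zero]
    refine isInternal_of_proj (M := LinearMap.ker f.hom.hom)
      (fun γ => ((M.proj γ).comp (LinearMap.ker f.hom.hom).subtype.toAddMonoidHom).codRestrict
        (LinearMap.ker f.hom.hom).toAddSubgroup (hk γ)) ?_ ?_ ?_ ?_
    · intro γ m hm
      exact Subtype.ext (projOf_same M.isInternal hm)
    · intro γ δ h m hm
      exact Subtype.ext (projOf_ne M.isInternal h hm)
    · intro γ m
      exact projOf_mem M.isInternal γ m.1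
    · intro m
      obtain ⟨s, hs⟩ := exists_sum_projOf M.isInternal m.1
      refine ⟨s, Subtype.ext ?_⟩
      refine hs.trans (Eq.symm ?_)
      exact map_sum (LinearMap.ker f.hom.hom).toAddSubgroup.subtype _ s
  smul_mem {γ δ m r} hm hr := M.smul_mem (m := m.1) hm hr

/-- The inclusion of the kernel. -/
noncomputable def kerι (f : M ⟶ N) : kerObj f ⟶ M where
  hom := ModuleCat.ofHom (LinearMap.ker f.hom.hom).subtype
  map_mem h := h

theorem kerι_injective (f : M ⟶ N) : Function.Injective (kerι f).hom := Subtype.val_injective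

theorem kerι_comp (f : M ⟶ N) : kerι f ≫ f = 0 := by
  ext x
  exact x.2

/-- The cokernel of a homomorphism of graded modules, with the induced grading. -/
noncomputable def cokerObj (f : M ⟶ N) : GrMod.{w, v, u} 𝓡 where
  toMod := ModuleCat.of Rᵐᵒᵖ (N.toMod ⧸ LinearMap.range f.hom.hom)
  gr γ := (N.gr γ).map (LinearMap.range f.hom.hom).mkQ.toAddMonoidHom
  isInternal := by
    have hk : ∀ γ : Γ, (LinearMap.range f.hom.hom).toAddSubgroup ≤
        (LinearMap.range f.hom.hom).toAddSubgroup.comap (N.proj γ) := by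
      rintro γ _ ⟨x, rfl⟩
      exact ⟨M.proj γ x, hom_proj f γ x⟩
    refine isInternal_of_proj (M := N.toMod ⧸ LinearMap.range f.hom.hom)
      (fun γ => QuotientAddGroup.map (LinearMap.range f.hom.hom).toAddSubgroup
        (LinearMap.range f.hom.hom).toAddSubgroup (N.proj γ) (hk γ)) ?_ ?_ ?_ ?_
    · rintro γ _ ⟨m, hm, rfl⟩
      exact congrArg (LinearMap.range f.hom.hom).mkQ (projOf_same N.isInternal hm)
    · rintro γ δ h _ ⟨m, hm, rfl⟩
      exact congrArg (LinearMap.range f.hom.hom).mkQ (projOf_ne N.isInternal h hm)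
    · intro γ m
      obtain ⟨m, rfl⟩ := (LinearMap.range f.hom.hom).mkQ_surjective m
      exact ⟨N.proj γ m, projOf_mem N.isInternal γ m, rfl⟩
    · intro m
      obtain ⟨m, rfl⟩ := (LinearMap.range f.hom.hom).mkQ_surjective m
      obtain ⟨s, hs⟩ := exists_sum_projOf N.isInternal m
      refine ⟨s, ?_⟩
      refine (congrArg (LinearMap.range f.hom.hom).mkQ hs).trans ?_
      exact map_sum (LinearMap.range f.hom.hom).mkQ _ s
  smul_mem := by
    rintro γ δ _ r ⟨m, hm, rfl⟩ hr
    exact ⟨MulOpposite.op r • m, N.smul_mem hm hr, rfl⟩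

/-- The projection onto the cokernel. -/
noncomputable def cokerπ (f : M ⟶ N) : N ⟶ cokerObj f where
  hom := ModuleCat.ofHom (LinearMap.range f.hom.hom).mkQ
  map_mem h := ⟨_, h, rfl⟩

theorem cokerπ_surjective (f : M ⟶ N) : Function.Surjective (cokerπ f).hom :=
  (LinearMap.range f.hom.hom).mkQ_surjective

theorem cokerπ_eq_zero_iff (f : M ⟶ N) (x : N.toMod) :
    (cokerπ f).hom x = 0 ↔ ∃ m, f.hom m = x :=
  Submodule.Quotient.mk_eq_zero _

theorem comp_cokerπ (f : M ⟶ N) : f ≫ cokerπ f = 0 := by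
  ext x
  exact (cokerπ_eq_zero_iff f _).2 ⟨x, rfl⟩

/-- An injective homomorphism onto the kernel of `g` is a kernel of `g`. -/
noncomputable def isKernel (f : M ⟶ N) (g : N ⟶ K) (w : f ≫ g = 0)
    (hf : Function.Injective f.hom) (h : ∀ x, g.hom x = 0 → ∃ m, f.hom m = x) :
    IsLimit (KernelFork.ofι f w) := by
  let e := LinearEquiv.ofInjective f.hom.hom hf
  have he : ∀ y : LinearMap.range f.hom.hom, f.hom (e.symm y) = y.1 := fun y =>
    congrArg Subtype.val (e.apply_symm_apply y)
  have hr : ∀ {W : GrMod.{w, v, u} 𝓡} (k : W ⟶ N), k ≫ g = 0 →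
      ∀ x, k.hom x ∈ LinearMap.range f.hom.hom := fun k hk x =>
    h _ (by
      have h1 : (k ≫ g).hom x = 0 := by rw [hk]; rfl
      exact h1)
  let l : ∀ {W : GrMod.{w, v, u} 𝓡} (k : W ⟶ N), k ≫ g = 0 → (W ⟶ M) := fun k hk =>
    { hom := ModuleCat.ofHom (e.symm.toLinearMap.comp (k.hom.hom.codRestrict _ (hr k hk)))
      map_mem := fun {γ m} hm => mem_of_injective f hf (by
        have h1 : f.hom (e.symm ⟨k.hom m, hr k hk m⟩) = k.hom m := he ⟨k.hom m, hr k hk m⟩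
        have h2 := k.map_mem hm
        rw [← h1] at h2
        exact h2) }
  have hl : ∀ {W : GrMod.{w, v, u} 𝓡} (k : W ⟶ N) (hk : k ≫ g = 0), l k hk ≫ f = k := by
    intro W k hk
    ext x
    exact he ⟨k.hom x, hr k hk x⟩
  refine KernelFork.IsLimit.ofι f w (fun k hk => l k hk) (fun k hk => hl k hk) ?_
  intro W k hk b hb
  ext x
  apply hf
  have h1 : (b ≫ f).hom x = (l k hk ≫ f).hom x := by rw [hb, hl k hk]
  exact h1

/-- A surjective homomorphism whose kernel is the image of `f` is a cokernel of `f`. -/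
noncomputable def isCokernel (f : M ⟶ N) (g : N ⟶ K) (w : f ≫ g = 0)
    (hg : Function.Surjective g.hom) (h : ∀ x, g.hom x = 0 → ∃ m, f.hom m = x) :
    IsColimit (CokernelCofork.ofπ g w) := by
  let e := g.hom.hom.quotKerEquivOfSurjective hg
  have he : ∀ y, e.symm (g.hom y) = Submodule.Quotient.mk y := fun y => by
    rw [LinearEquiv.symm_apply_eq]
    rfl
  have hr : ∀ {W : GrMod.{w, v, u} 𝓡} (k : N ⟶ W), f ≫ k = 0 →
      LinearMap.ker g.hom.hom ≤ LinearMap.ker k.hom.hom := fun k hk x hx => by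
    obtain ⟨m, rfl⟩ := h x hx
    have h1 : (f ≫ k).hom m = 0 := by rw [hk]; rfl
    exact h1
  have hd : ∀ {W : GrMod.{w, v, u} 𝓡} (k : N ⟶ W) (hk : f ≫ k = 0) (y : N.toMod),
      ((LinearMap.ker g.hom.hom).liftQ k.hom.hom (hr k hk)) (e.symm (g.hom y)) = k.hom y := by
    intro W k hk y
    rw [he]
    rfl
  let l : ∀ {W : GrMod.{w, v, u} 𝓡} (k : N ⟶ W), f ≫ k = 0 → (K ⟶ W) := fun k hk =>
    { hom := ModuleCat.ofHom
        (((LinearMap.ker g.hom.hom).liftQ k.hom.hom (hr k hk)).comp e.symm.toLinearMap)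
      map_mem := fun {γ m} hm => by
        obtain ⟨y, rfl⟩ := hg m
        obtain ⟨y', hy', hyy⟩ := exists_lift_of_mem g hm
        rw [← hyy]
        have h2 := k.map_mem hy'
        rw [← hd k hk y'] at h2
        exact h2 }
  have hl : ∀ {W : GrMod.{w, v, u} 𝓡} (k : N ⟶ W) (hk : f ≫ k = 0), g ≫ l k hk = k := by
    intro W k hk
    ext x
    exact hd k hk x
  refine CokernelCofork.IsColimit.ofπ g w (fun k hk => l k hk) (fun k hk => hl k hk) ?_
  intro W k hk b hb
  ext x
  obtain ⟨y, rfl⟩ := hg x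
  have h1 : (g ≫ b).hom y = (g ≫ l k hk).hom y := by rw [hb, hl k hk]
  exact h1

instance : HasKernels (GrMod.{w, v, u} 𝓡) where
  has_limit f := ⟨⟨⟨_, isKernel (kerι f) f (kerι_comp f) (kerι_injective f)
    fun x hx => ⟨⟨x, hx⟩, rfl⟩⟩⟩⟩

instance : HasCokernels (GrMod.{w, v, u} 𝓡) where
  has_colimit f := ⟨⟨⟨_, isCokernel f (cokerπ f) (comp_cokerπ f) (cokerπ_surjective f)
    fun x hx => (cokerπ_eq_zero_iff f x).1 hx⟩⟩⟩

theorem injective_of_mono (f : M ⟶ N) [Mono f] : Function.Injective f.hom := by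
  have h : kerι f = 0 := by
    rw [← cancel_mono f, kerι_comp, zero_comp]
  refine (injective_iff_map_eq_zero f.hom.hom).2 fun x hx => ?_
  have h1 : (kerι f).hom ⟨x, hx⟩ = (0 : kerObj f ⟶ M).hom ⟨x, hx⟩ := by rw [h]
  exact h1

theorem surjective_of_epi (f : M ⟶ N) [Epi f] : Function.Surjective f.hom := by
  have h : cokerπ f = 0 := by
    rw [← cancel_epi f, comp_cokerπ, comp_zero]
  intro x
  refine (cokerπ_eq_zero_iff f x).1 ?_
  rw [h]
  rfl

instance : IsNormalMonoCategory (GrMod.{w, v, u} 𝓡) where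
  normalMonoOfMono f _ := ⟨
    { Z := cokerObj f
      g := cokerπ f
      w := comp_cokerπ f
      isLimit := isKernel f (cokerπ f) (comp_cokerπ f) (injective_of_mono f)
        fun x hx => (cokerπ_eq_zero_iff f x).1 hx }⟩

instance : IsNormalEpiCategory (GrMod.{w, v, u} 𝓡) where
  normalEpiOfEpi f _ := ⟨
    { W := kerObj f
      g := kerι f
      w := kerι_comp f
      isColimit := isCokernel (kerι f) f (kerι_comp f) (surjective_of_epi f)
        fun x hx => ⟨⟨x, hx⟩, rfl⟩ }⟩

/-- The zero graded module. -/
def zeroObj (𝓡 : Γ → AddSubgroup R) : GrMod.{w, v, u} 𝓡 where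
  toMod := ModuleCat.of Rᵐᵒᵖ PUnit
  gr _ := ⊤
  isInternal := isInternal_of_proj (M := PUnit) (fun _ => 0) (fun _ _ _ => rfl)
    (fun _ _ _ _ _ => rfl) (fun _ _ => trivial) (fun _ => ⟨∅, rfl⟩)
  smul_mem _ _ := trivial

instance : HasZeroObject (GrMod.{w, v, u} 𝓡) :=
  ⟨zeroObj 𝓡, by
    rw [IsZero.iff_id_eq_zero]
    ext x
    rfl⟩

/-- The direct sum of two graded modules. -/
noncomputable def prodObj (M N : GrMod.{w, v, u} 𝓡) : GrMod.{w, v, u} 𝓡 where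
  toMod := ModuleCat.of Rᵐᵒᵖ (M.toMod × N.toMod)
  gr γ := (M.gr γ).prod (N.gr γ)
  isInternal := by
    have hsum : ∀ (K : GrMod.{w, v, u} 𝓡) (m : K.toMod) (s t : Finset Γ), s ⊆ t →
        m = ∑ γ ∈ s, K.proj γ m → m = ∑ γ ∈ t, K.proj γ m := by
      intro K m s t hst hs
      rw [← Finset.sum_subset hst]
      · exact hs
      · intro γ _ hγ
        rw [hs, map_sum]
        refine Finset.sum_eq_zero fun δ hδ => ?_
        refine projOf_ne _ ?_ (projOf_mem K.isInternal δ m)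
        rintro rfl
        exact hγ hδ
    refine isInternal_of_proj (M := M.toMod × N.toMod)
      (fun γ => (M.proj γ).prodMap (N.proj γ)) ?_ ?_ ?_ ?_
    · intro γ m hm
      exact Prod.ext (projOf_same _ hm.1) (projOf_same _ hm.2)
    · intro γ δ h m hm
      exact Prod.ext (projOf_ne _ h hm.1) (projOf_ne _ h hm.2)
    · intro γ m
      exact ⟨projOf_mem _ _ _, projOf_mem _ _ _⟩
    · intro m
      obtain ⟨s, hs⟩ := exists_sum_projOf M.isInternal m.1
      obtain ⟨t, ht⟩ := exists_sum_projOf N.isInternal m.2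
      refine ⟨s ∪ t, Prod.ext ?_ ?_⟩
      · rw [Prod.fst_sum]
        exact hsum M m.1 s _ Finset.subset_union_left hs
      · rw [Prod.snd_sum]
        exact hsum N m.2 t _ Finset.subset_union_right ht
  smul_mem hm hr := ⟨M.smul_mem hm.1 hr, N.smul_mem hm.2 hr⟩

instance : HasBinaryBiproducts (GrMod.{w, v, u} 𝓡) where
  has_binary_biproduct M N := hasBinaryBiproduct_of_total
    { pt := prodObj M N
      fst := ⟨ModuleCat.ofHom (LinearMap.fst Rᵐᵒᵖ M.toMod N.toMod), fun h => h.1⟩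
      snd := ⟨ModuleCat.ofHom (LinearMap.snd Rᵐᵒᵖ M.toMod N.toMod), fun h => h.2⟩
      inl := ⟨ModuleCat.ofHom (LinearMap.inl Rᵐᵒᵖ M.toMod N.toMod),
        fun h => ⟨h, (N.gr _).zero_mem⟩⟩
      inr := ⟨ModuleCat.ofHom (LinearMap.inr Rᵐᵒᵖ M.toMod N.toMod),
        fun h => ⟨(M.gr _).zero_mem, h⟩⟩
      inl_fst := by ext; rfl
      inl_snd := by ext; rfl
      inr_fst := by ext; rfl
      inr_snd := by ext; rfl }
    (by
      ext x
      exact Prod.ext (add_zero x.1) (zero_add x.2))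

instance : HasFiniteProducts (GrMod.{w, v, u} 𝓡) :=
  hasFiniteProducts_of_has_binary_and_terminal

instance : Abelian (GrMod.{w, v, u} 𝓡) where

end GrMod

/-! ### Injective generation -/

/-- Injectives generate for the ring `R`: the smallest localizing subcategory of the derived
category of right `R`-modules containing the injective modules is the whole derived category. -/
def InjectivesGenerate (R : Type u) [Ring R] [HasDerivedCategory.{w'} (ModuleCat.{u} Rᵐᵒᵖ)] : Prop :=
  Loc.{u} (inDegreeZero fun I : ModuleCat.{u} Rᵐᵒᵖ => Injective I) = ⊤

/-- Graded injectives generate for the graded ring `R = ⨁ γ, 𝓡 γ`: the smallest localizing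
subcategory of the derived category of graded right `R`-modules containing the injective objects
of the category of graded modules is the whole derived category. -/
def GradedInjectivesGenerate {Γ : Type w} [AddCommGroup Γ] [DecidableEq Γ] {R : Type u} [Ring R]
    (𝓡 : Γ → AddSubgroup R) [HasDerivedCategory.{w'} (GrMod.{w, u, u} 𝓡)] : Prop :=
  Loc.{u} (inDegreeZero fun I : GrMod.{w, u, u} 𝓡 => Injective I) = ⊤

/-!
Write `U` for the functor forgetting the grading, from graded to ungraded modules. Its right adjoint
is coinduction `G`, where `G M` consists of the functions `Γ → M`, its component of degree `γ` being
the functions supported at `γ`, and a homogeneous `r ∈ R_δ` acting by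
`(f r) (γ) = f (γ - δ) r`. Since `Γ` is finite, sums over `Γ` make sense and `G` is also left
adjoint to `U` (`GrMod.forgetAdjCoind`, `GrMod.coindAdjForget`). Hence both functors are exact and
preserve injectives and coproducts. Both are faithful, hence conservative.

The theorem is then two instances of `Loc_injective_eq_top_of_adjunctions`: if `F ⊣ H ⊣ F` with `H`
conservative, injective generation passes from the source of `F` to its target. The induced functors
on derived categories have the same properties. If injectives generate upstairs, every `F X` lies in
the localizing subcategory `L` generated by the injectives downstairs, because `F` preserves
injectives and coproducts. It remains to see that a localizing subcategory `L` containing the image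
of `F` is everything (`IsLocalizing.eq_top_of_adjunction`). For each `X`, the cofibre
`δ : X ⟶ Y` of the counit `F H X ⟶ X` has its cone in `L`, and `H δ = 0` because `H` of the counit
is a split epimorphism. Iterating yields a sequence `X = X₀ ⟶ X₁ ⟶ ⋯`. As `H` kills its transition
maps, it sends `1 - shift : ∐ Xₙ ⟶ ∐ Xₙ` to an identity, so this map is an isomorphism and the
homotopy colimit of the sequence vanishes. On the other hand the sequence agrees, up to
cones in `L`, with the constant sequence `X`, whose homotopy colimit is `X`; so `X` is in `L`.

This argument needs countable coproducts in the derived category. They are obtained from exact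
coproducts of the abelian category (`DerivedCategory.hasCoproductsOfShape`): coproducts of complexes
descend to the homotopy category, and then to its localization, as acyclic complexes are stable
under coproducts. For graded modules, coproducts and their exactness are inherited along `U`, which
is comonadic.
-/

/-! ### Cones in a triangulated subcategory -/

namespace CategoryTheory.ObjectProperty

variable {T : Type*} [Category* T] [HasZeroObject T] [HasShift T ℤ] [Preadditive T]
  [∀ n : ℤ, (shiftFunctor T n).Additive] [Pretriangulated T]

theorem trW_isStableUnderProductsOfShape (P : ObjectProperty T) [P.IsTriangulated]
    [P.IsClosedUnderIsomorphisms] (J : Type*) [HasProductsOfShape J T]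
    [P.IsClosedUnderLimitsOfShape (Discrete J)] : P.trW.IsStableUnderProductsOfShape J := by
  refine MorphismProperty.IsStableUnderProductsOfShape.mk _ _ fun X₁ X₂ _ _ f hf => ?_
  choose Z g h hT hZ using hf
  exact trW.mk _ (productTriangle_distinguished _ hT) (P.prop_pi _ hZ)

open Pretriangulated.Opposite in
/-- If `P` is closed under coproducts, then so is the class of morphisms whose cone is in `P`:
a coproduct of distinguished triangles is distinguished. -/
theorem trW_isStableUnderCoproductsOfShape (P : ObjectProperty T) [P.IsTriangulated]
    [P.IsClosedUnderIsomorphisms] (J : Type*) [HasCoproductsOfShape J T]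
    [P.IsClosedUnderColimitsOfShape (Discrete J)] : P.trW.IsStableUnderCoproductsOfShape J := by
  have : HasProductsOfShape J Tᵒᵖ := inferInstance
  have : P.IsClosedUnderColimitsOfShape (Discrete J)ᵒᵖ :=
    .of_equivalence (Discrete.opposite J).symm
  have := P.op.trW_isStableUnderProductsOfShape J
  refine MorphismProperty.IsStableUnderCoproductsOfShape.mk _ _ fun X₁ X₂ _ _ f hf => ?_
  apply P.trW_of_op
  have h₁ : IsLimit (Cofan.op (Cofan.mk (∐ X₁) (Sigma.ι X₁))) :=
    Cofan.IsColimit.op (coproductIsCoproduct X₁)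
  have h₂ : IsLimit (Cofan.op (Cofan.mk (∐ X₂) (Sigma.ι X₂))) :=
    Cofan.IsColimit.op (coproductIsCoproduct X₂)
  refine MorphismProperty.IsStableUnderLimitsOfShape.condition _ _ _ _ h₂ h₁
    (Discrete.natTrans fun j => (f j.as).op) (fun j => ?_) _ fun j => ?_
  · exact P.trW_op_iff.2 (hf j.as)
  · exact Quiver.Hom.unop_inj (by simp)

/-- By the octahedral axiom the cone of `f` sits in a triangle with those of `g` and `f ≫ g`. -/
theorem trW_of_postcomp [IsTriangulated T] (P : ObjectProperty T) [P.IsTriangulated]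
    [P.IsClosedUnderIsomorphisms] {X Y Z : T} {f : X ⟶ Y} {g : Y ⟶ Z} (hg : P.trW g)
    (hfg : P.trW (f ≫ g)) : P.trW f := by
  obtain ⟨A, a, a', hA⟩ := distinguished_cocone_triangle f
  obtain ⟨B, b, b', hB, hPB⟩ := hg
  obtain ⟨C, c, c', hC, hPC⟩ := hfg
  exact trW.mk _ hA (P.ext_of_isTriangulatedClosed₁ _
    (Triangulated.someOctahedron rfl hA hB hC).mem hPC hPB)

/-- The cone of a split monomorphism is a complement of it. -/
theorem trW_iff_of_split (P : ObjectProperty T) [P.IsClosedUnderIsomorphisms] {A B X : T}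
    (f : A ⟶ B) (r : B ⟶ A) (i : X ⟶ B) (p : B ⟶ X) (hfr : f ≫ r = 𝟙 A) (hip : i ≫ p = 𝟙 X)
    (hfp : f ≫ p = 0) (h : r ≫ f + p ≫ i = 𝟙 B) : P.trW f ↔ P X := by
  have hir : i ≫ r = 0 := by
    have h1 : i ≫ (r ≫ f + p ≫ i) ≫ r = i ≫ 𝟙 B ≫ r := by rw [h]
    simpa [hfr, reassoc_of% hip] using h1
  let e : A ⊞ X ≅ B :=
    { hom := biprod.desc f i
      inv := biprod.lift r p
      hom_inv_id := by ext <;> simp [hfr, hip, hfp, hir]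
      inv_hom_id := by simp [h] }
  have e' : Arrow.mk f ≅ Arrow.mk (biprod.inl : A ⟶ A ⊞ X) :=
    Arrow.isoMk (Iso.refl _) e.symm (by
      refine (Category.id_comp _).trans ?_
      refine biprod.hom_ext _ _ ?_ ?_ <;> simp [e, hfr, hfp])
  rw [P.trW.arrow_mk_iso_iff e']
  exact P.trW_iff_of_distinguished _ (binaryBiproductTriangle_distinguished A X)

end CategoryTheory.ObjectProperty

/-! ### Homotopy colimits of sequences -/

namespace CategoryTheory.Limits

variable {T : Type*} [Category* T] [HasCoproductsOfShape ℕ T]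

/-- The shift endomorphism of the coproduct of a sequence `X 0 ⟶ X 1 ⟶ ⋯`; the homotopy colimit
of the sequence is the cone of its difference with the identity. -/
noncomputable def sequenceShift {X : ℕ → T} (φ : ∀ n, X n ⟶ X (n + 1)) : ∐ X ⟶ ∐ X :=
  Limits.Sigma.desc fun n => φ n ≫ Sigma.ι X (n + 1)

@[simp]
theorem ι_sequenceShift {X : ℕ → T} (φ : ∀ n, X n ⟶ X (n + 1)) (n : ℕ) :
    Sigma.ι X n ≫ sequenceShift φ = φ n ≫ Sigma.ι X (n + 1) := by
  simp [sequenceShift]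

end CategoryTheory.Limits

namespace CategoryTheory.ObjectProperty

variable {T : Type*} [Category* T] [HasZeroObject T] [HasShift T ℤ] [Preadditive T]
  [∀ n : ℤ, (shiftFunctor T n).Additive] [Pretriangulated T] [HasCoproductsOfShape ℕ T]

/-- The homotopy colimit of a constant sequence is the constant value. -/
theorem trW_id_sub_sequenceShift_iff (P : ObjectProperty T) [P.IsClosedUnderIsomorphisms] (X : T) :
    P.trW (𝟙 _ - sequenceShift fun _ : ℕ => 𝟙 X) ↔ P X := by
  obtain ⟨ι, hι⟩ : ∃ ι : ℕ → (X ⟶ ∐ fun _ : ℕ => X), ι = Sigma.ι fun _ => X := ⟨_, rfl⟩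
  have hext : ∀ {Z : T} (f g : (∐ fun _ : ℕ => X) ⟶ Z), (∀ n, ι n ≫ f = ι n ≫ g) → f = g :=
    fun f g h => Sigma.hom_ext _ _ fun n => by simpa only [hι] using h n
  obtain ⟨σ, hσ', hσ⟩ : ∃ σ : (∐ fun _ : ℕ => X) ⟶ (∐ fun _ : ℕ => X),
      (sequenceShift fun _ : ℕ => 𝟙 X) = σ ∧ ∀ n, ι n ≫ σ = ι (n + 1) :=
    ⟨_, rfl, fun n => by simp [hι]⟩
  obtain ⟨p, hp⟩ : ∃ p : (∐ fun _ : ℕ => X) ⟶ X, ∀ n, ι n ≫ p = 𝟙 X :=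
    ⟨Limits.Sigma.desc fun _ => 𝟙 X, fun n => by simp [hι]⟩
  -- The retraction sends the `n`-th copy of `X` diagonally to minus the sum of the previous ones.
  obtain ⟨r, hr⟩ : ∃ r : (∐ fun _ : ℕ => X) ⟶ (∐ fun _ : ℕ => X),
      ∀ n, ι n ≫ r = -∑ k ∈ Finset.range n, ι k :=
    ⟨Limits.Sigma.desc fun n => -∑ k ∈ Finset.range n, ι k, fun n => by simp [hι]⟩
  rw [hσ']
  refine P.trW_iff_of_split (𝟙 _ - σ) r (ι 0) p (hext _ _ fun n => ?_) (hp 0)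
    (hext _ _ fun n => ?_) (hext _ _ fun n => ?_)
  · simp [Preadditive.comp_sub, Preadditive.sub_comp, Finset.sum_range_succ, hr, reassoc_of% hσ]
  · simp [Preadditive.comp_sub, Preadditive.sub_comp, hp, reassoc_of% hσ]
  · have h : -∑ k ∈ Finset.range n, ι k - -∑ k ∈ Finset.range n, ι (k + 1) + ι 0 = ι n := by
      rw [sub_neg_eq_add, neg_add_eq_sub, ← Finset.sum_sub_distrib, Finset.sum_range_sub]
      abel
    simpa only [Preadditive.comp_add, hr, reassoc_of% hr, reassoc_of% hp, Preadditive.neg_comp,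
      Preadditive.sum_comp, Preadditive.comp_sub, Category.comp_id, hσ] using h

/-- If the transition maps of a sequence have cones in a triangulated subcategory `P` closed under
countable coproducts and its homotopy colimit vanishes, then its first term is in `P`. -/
theorem prop_zero_of_isIso_id_sub_sequenceShift [IsTriangulated T] (P : ObjectProperty T)
    [P.IsTriangulated] [P.IsClosedUnderIsomorphisms] [P.IsClosedUnderColimitsOfShape (Discrete ℕ)]
    {X : ℕ → T} (φ : ∀ n, X n ⟶ X (n + 1)) (hφ : ∀ n, P.trW (φ n))
    (hX : IsIso (𝟙 _ - sequenceShift φ)) : P (X 0) := by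
  let ψ : ∀ n, X 0 ⟶ X n := fun n => Nat.rec (𝟙 _) (fun n f => f ≫ φ n) n
  have hψ : ∀ n, P.trW (ψ n) := by
    intro n
    induction n with
    | zero => exact P.trW.id_mem _
    | succ n ih => exact P.trW.comp_mem _ _ ih (hφ n)
  have := P.trW_isStableUnderCoproductsOfShape ℕ
  have hg : P.trW (Limits.Sigma.map ψ) :=
    MorphismProperty.colimMap (W := P.trW) _ fun n => hψ n.as
  -- The canonical map from the constant sequence `X 0` to `X` compares the two endomorphisms
  -- whose cones are the homotopy colimits.
  have comm : (𝟙 _ - sequenceShift fun _ : ℕ => 𝟙 (X 0)) ≫ Limits.Sigma.map ψ =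
      Limits.Sigma.map ψ ≫ (𝟙 _ - sequenceShift φ) := by
    refine Sigma.hom_ext _ _ fun n => ?_
    have hs : ψ (n + 1) = ψ n ≫ φ n := rfl
    simp [Preadditive.comp_sub, Preadditive.sub_comp, hs, reassoc_of% ι_sequenceShift]
  rw [← P.trW_id_sub_sequenceShift_iff]
  refine P.trW_of_postcomp hg ?_
  rw [comm]
  exact P.trW.comp_mem _ _ hg (P.trW_of_isIso _)

/-- A triangulated subcategory closed under countable coproducts is everything as soon as each
object admits a morphism with cone in it that is killed by a conservative functor preserving
countable coproducts. -/
theorem eq_top_of_forall_exists_trW [IsTriangulated T] (P : ObjectProperty T)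
    [P.IsTriangulated] [P.IsClosedUnderIsomorphisms] [P.IsClosedUnderColimitsOfShape (Discrete ℕ)]
    {S : Type*} [Category* S] [Preadditive S] (H : T ⥤ S) [H.Additive] [H.ReflectsIsomorphisms]
    [PreservesColimitsOfShape (Discrete ℕ) H]
    (hP : ∀ X : T, ∃ (Y : T) (f : X ⟶ Y), P.trW f ∧ H.map f = 0) : P = ⊤ := by
  rw [eq_top_iff]
  intro X _
  choose c f hf hHf using hP
  -- Iterating the given morphisms yields a sequence whose transition maps are killed by `H`, so
  -- that `H` sends `𝟙 - shift` to an identity.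
  let Y : ℕ → T := fun n => Nat.rec X (fun _ Z => c Z) n
  let φ : ∀ n, Y n ⟶ Y (n + 1) := fun n => f (Y n)
  refine P.prop_zero_of_isIso_id_sub_sequenceShift φ (fun n => hf _) ?_
  have h0 : H.map (sequenceShift φ) = 0 := by
    refine (isColimitOfPreserves H (coproductIsCoproduct Y)).hom_ext fun ⟨n⟩ => ?_
    have : H.map (Sigma.ι Y n) ≫ H.map (sequenceShift φ) = 0 := by
      rw [← H.map_comp, ι_sequenceShift, H.map_comp, hHf, zero_comp]
    simpa using this
  have : IsIso (H.map (𝟙 _ - sequenceShift φ)) := by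
    rw [H.map_sub, h0, H.map_id, sub_zero]
    infer_instance
  exact isIso_of_reflects_iso _ H

end CategoryTheory.ObjectProperty

/-- If the left adjoint of a conservative functor `H` that preserves countable coproducts takes all
its values in a localizing subcategory, then this subcategory is everything. -/
theorem IsLocalizing.eq_top_of_adjunction {T : Type*} [Category* T] [HasZeroObject T]
    [HasShift T ℤ] [Preadditive T] [∀ n : ℤ, (shiftFunctor T n).Additive] [Pretriangulated T]
    [IsTriangulated T] [HasCoproductsOfShape ℕ T] {S : Type*} [Category* S] [Preadditive S]
    {F : S ⥤ T} {H : T ⥤ S} (adj : F ⊣ H) [H.Additive] [H.ReflectsIsomorphisms]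
    [PreservesColimitsOfShape (Discrete ℕ) H] {P : ObjectProperty T} (hP : IsLocalizing.{w} P)
    (hF : ∀ X, P (F.obj X)) : P = ⊤ := by
  have := hP.isTriangulated
  have := hP.isClosedUnderIsomorphisms
  have := hP.isClosedUnderCoproducts (ULift ℕ)
  have : P.IsClosedUnderColimitsOfShape (Discrete ℕ) :=
    .of_equivalence (Discrete.equivalence Equiv.ulift)
  refine P.eq_top_of_forall_exists_trW H fun X => ?_
  obtain ⟨Y, f, g, hT⟩ := distinguished_cocone_triangle (adj.counit.app X)
  -- By the triangle identity `H` sends the counit to a split epimorphism, hence kills its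
  -- cofibre `f`.
  refine ⟨Y, f, (P.trW_iff_of_distinguished' _ hT).2 (hF _), ?_⟩
  have h0 : adj.counit.app X ≫ f = 0 := comp_distTriang_mor_zero₁₂ _ hT
  have h1 := adj.right_triangle_components X
  calc H.map f = adj.unit.app (H.obj X) ≫ H.map (adj.counit.app X) ≫ H.map f := by
        rw [← Category.assoc, h1]; exact (Category.id_comp _).symm
    _ = 0 := by rw [← H.map_comp, h0, H.map_zero, comp_zero]

/-! ### Coproducts in localizations -/

namespace CategoryTheory

theorem Limits.hasCoproductsOfShape_of_isColimit_cofan {C : Type*} [Category* C] (J : Type*)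
    (h : ∀ X : J → C, ∃ c : Cofan X, Nonempty (IsColimit c)) : HasCoproductsOfShape J C where
  has_colimit F := by
    obtain ⟨c, ⟨hc⟩⟩ := h fun j => F.obj ⟨j⟩
    have : HasColimit (Discrete.functor (F.obj ∘ Discrete.mk)) := ⟨⟨_, hc⟩⟩
    exact hasColimit_of_iso Discrete.natIsoFunctor

section Localization

variable {C D : Type*} [Category* C] [Category* D]

/-- Morphisms `L.obj (X j) ⟶ L.obj Y` are right fractions; the coproduct of their denominators is
again in `W`, so that they assemble to a right fraction out of the coproduct. -/
theorem Localization.exists_desc_coproduct (L : C ⥤ D) (W : MorphismProperty C)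
    [L.IsLocalization W] [W.HasRightCalculusOfFractions]
    (J : Type*) [HasCoproductsOfShape J C] [W.IsStableUnderCoproductsOfShape J]
    {X : J → C} {Y : C} (f : ∀ j, L.obj (X j) ⟶ L.obj Y) :
    ∃ g : L.obj (∐ X) ⟶ L.obj Y, ∀ j, L.map (Sigma.ι X j) ≫ g = f j := by
  choose φ hφ using fun j => Localization.exists_rightFraction L W (f j)
  have hW : W (Limits.Sigma.map fun j => (φ j).s) :=
    MorphismProperty.colimMap (W := W) _ fun j => (φ j.as).hs
  have := Localization.inverts L W _ hW
  refine ⟨inv (L.map (Limits.Sigma.map fun j => (φ j).s)) ≫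
    L.map (Limits.Sigma.desc fun j => (φ j).f), fun j => ?_⟩
  have hs := Localization.inverts L W _ (φ j).hs
  rw [hφ, ← cancel_epi (L.map (φ j).s), MorphismProperty.RightFraction.map_s_comp_map,
    ← L.map_comp_assoc, ← Limits.Sigma.ι_map (fun j => (φ j).s), L.map_comp_assoc,
    IsIso.hom_inv_id_assoc, ← L.map_comp, Limits.Sigma.ι_desc]

theorem Localization.hom_ext_coproduct (L : C ⥤ D) (W : MorphismProperty C)
    [L.IsLocalization W] [W.HasLeftCalculusOfFractions] [W.HasRightCalculusOfFractions]
    (J : Type*) [HasCoproductsOfShape J C] [W.IsStableUnderCoproductsOfShape J]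
    {X : J → C} {Y : C} (f g : L.obj (∐ X) ⟶ L.obj Y)
    (h : ∀ j, L.map (Sigma.ι X j) ≫ f = L.map (Sigma.ι X j) ≫ g) : f = g := by
  obtain ⟨φ, rfl, rfl⟩ := Localization.exists_leftFraction₂ L W f g
  have hs := Localization.inverts L W _ φ.hs
  have h' : ∀ j, L.map (Sigma.ι X j ≫ φ.f) = L.map (Sigma.ι X j ≫ φ.f') := fun j => by
    have := h j =≫ L.map φ.s
    simpa [MorphismProperty.LeftFraction₂.fst, MorphismProperty.LeftFraction₂.snd,
      MorphismProperty.LeftFraction.map] using this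
  choose X' t ht htt using fun j => (MorphismProperty.map_eq_iff_precomp L W _ _).1 (h' j)
  have hW : W (Limits.Sigma.map t) := MorphismProperty.colimMap (W := W) _ fun j => ht j.as
  have key : L.map φ.f = L.map φ.f' := by
    have := Localization.inverts L W _ hW
    rw [← cancel_epi (L.map (Limits.Sigma.map t)), ← L.map_comp, ← L.map_comp]
    congr 1
    exact Sigma.hom_ext _ _ fun j => by simpa using htt j
  simp [MorphismProperty.LeftFraction₂.fst, MorphismProperty.LeftFraction₂.snd,
      MorphismProperty.LeftFraction.map, key]

/-- A localization functor with respect to a class of morphisms which has a calculus of left and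
right fractions and is stable under coproducts preserves coproducts. -/
theorem Localization.nonempty_isColimit_map_cofan (L : C ⥤ D) (W : MorphismProperty C)
    [L.IsLocalization W] [W.HasLeftCalculusOfFractions] [W.HasRightCalculusOfFractions]
    (J : Type*) [HasCoproductsOfShape J C] [W.IsStableUnderCoproductsOfShape J]
    (X : J → C) :
    Nonempty (IsColimit (Cofan.mk (L.obj (∐ X)) fun j => L.map (Sigma.ι X j))) := by
  have := Localization.essSurj L W
  have hd : ∀ s : Cofan fun j => L.obj (X j), ∃ g : L.obj (∐ X) ⟶ s.pt,
      ∀ j, L.map (Sigma.ι X j) ≫ g = s.inj j := fun s => by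
    obtain ⟨g, hg⟩ := Localization.exists_desc_coproduct L W J
      fun j => s.inj j ≫ (L.objObjPreimageIso s.pt).inv
    exact ⟨g ≫ (L.objObjPreimageIso s.pt).hom, fun j => by simp [reassoc_of% hg]⟩
  refine ⟨Cofan.IsColimit.mk _ (fun s => (hd s).choose) (fun s j => (hd s).choose_spec j)
    fun s m hm => ?_⟩
  rw [← cancel_mono (L.objObjPreimageIso s.pt).inv]
  refine Localization.hom_ext_coproduct L W J _ _ fun j => ?_
  rw [reassoc_of% (hd s).choose_spec j, ← hm j]
  simp

theorem Localization.hasCoproductsOfShape (L : C ⥤ D) (W : MorphismProperty C)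
    [L.IsLocalization W] [W.HasLeftCalculusOfFractions] [W.HasRightCalculusOfFractions]
    (J : Type*) [HasCoproductsOfShape J C] [W.IsStableUnderCoproductsOfShape J] :
    HasCoproductsOfShape J D := by
  have := Localization.essSurj L W
  refine hasCoproductsOfShape_of_isColimit_cofan J fun X => ?_
  obtain ⟨h⟩ := Localization.nonempty_isColimit_map_cofan L W J fun j => L.objPreimage (X j)
  have : HasColimit (Discrete.functor fun j => L.obj (L.objPreimage (X j))) := ⟨⟨_, h⟩⟩
  let e : Discrete.functor X ≅ Discrete.functor fun j => L.obj (L.objPreimage (X j)) :=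
    Discrete.natIso fun j => (L.objObjPreimageIso (X j.as)).symm
  have : HasColimit (Discrete.functor X) := hasColimit_of_iso e
  exact ⟨_, ⟨colimit.isColimit _⟩⟩

end Localization

end CategoryTheory

/-! ### Coproducts in homotopy categories and derived categories -/

namespace HomotopyCategory

variable {C : Type*} [Category* C]

/-- Homotopies between morphisms out of a coproduct of complexes may be given on the summands. -/
theorem nonempty_homotopy_of_coproduct [Preadditive C] {ι : Type*} {c : ComplexShape ι} {J : Type*}
    [HasCoproductsOfShape J C] {K : J → HomologicalComplex C c} {L : HomologicalComplex C c}
    (f g : ∐ K ⟶ L) (h : ∀ j, Nonempty (Homotopy (Sigma.ι K j ≫ f) (Sigma.ι K j ≫ g))) :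
    Nonempty (Homotopy f g) := by
  let H := fun j => (h j).some
  let hc := fun i => isColimitOfPreserves (HomologicalComplex.eval C c i) (coproductIsCoproduct K)
  let s : ∀ i i', (∐ K).X i ⟶ L.X i' := fun i i' =>
    (hc i).desc ⟨_, Discrete.natTrans fun j => (H j.as).hom i i'⟩
  have hs : ∀ j i i', (Sigma.ι K j).f i ≫ s i i' = (H j).hom i i' := fun j i i' =>
    (hc i).fac _ ⟨j⟩
  refine ⟨⟨s, fun i i' hi => ?_, fun i => ?_⟩⟩
  · refine (hc i).hom_ext fun j => ((hs j.as i i').trans ?_).trans comp_zero.symm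
    exact (H j.as).zero i i' hi
  · refine (hc i).hom_ext fun j => ?_
    change (Sigma.ι K j.as).f i ≫ _ = (Sigma.ι K j.as).f i ≫ _
    have h1 := (H j.as).comm i
    have h2 : (H j.as).hom = fun i i' => (Sigma.ι K j.as).f i ≫ s i i' := by
      funext i i'
      exact (hs j.as i i').symm
    rw [h2, dNext_comp_left, prevD_comp_left] at h1
    simpa using h1

variable {ι : Type*} (c : ComplexShape ι) {J : Type*}

theorem nonempty_isColimit_quotient_cofan [Preadditive C] [HasCoproductsOfShape J C]
    (K : J → HomologicalComplex C c) :
    Nonempty (IsColimit (Cofan.mk ((quotient C c).obj (∐ K))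
      fun j => (quotient C c).map (Sigma.ι K j))) := by
  have hd : ∀ s : Cofan fun j => (quotient C c).obj (K j),
      ∃ g : (quotient C c).obj (∐ K) ⟶ s.pt,
        ∀ j, (quotient C c).map (Sigma.ι K j) ≫ g = s.inj j := by
    intro s
    obtain ⟨Y, hY⟩ := quotient_obj_surjective s.pt
    choose f hf using fun j => (quotient C c).map_surjective (s.inj j ≫ eqToHom hY.symm)
    refine ⟨(quotient C c).map (Limits.Sigma.desc f) ≫ eqToHom hY, fun j => ?_⟩
    rw [← Functor.map_comp_assoc, Limits.Sigma.ι_desc, hf]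
    simp
  refine ⟨Cofan.IsColimit.mk _ (fun s => (hd s).choose) (fun s j => (hd s).choose_spec j)
    fun s m hm => ?_⟩
  have hm' := fun j => (hm j).trans ((hd s).choose_spec j).symm
  generalize (hd s).choose = m' at hm'
  clear hm
  obtain ⟨Y, hY⟩ := quotient_obj_surjective s.pt
  rw [← cancel_mono (eqToHom hY.symm)]
  obtain ⟨f, hf⟩ := (quotient C c).map_surjective (m ≫ eqToHom hY.symm)
  obtain ⟨f', hf'⟩ := (quotient C c).map_surjective (m' ≫ eqToHom hY.symm)
  rw [← hf, ← hf']
  refine eq_of_homotopy _ _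
    (nonempty_homotopy_of_coproduct f f' fun j => ⟨homotopyOfEq _ _ ?_⟩).some
  rw [Functor.map_comp, Functor.map_comp, hf, hf']
  have h : (quotient C c).map (Sigma.ι K j) ≫ m = (quotient C c).map (Sigma.ι K j) ≫ m' := hm' j
  rw [← Category.assoc, h, Category.assoc]

variable (C J)

instance [Preadditive C] [HasCoproductsOfShape J C] :
    HasCoproductsOfShape J (HomotopyCategory C c) := by
  refine hasCoproductsOfShape_of_isColimit_cofan J fun X => ?_
  choose K hK using fun j => quotient_obj_surjective (X j)
  obtain rfl : (fun j => (quotient C c).obj (K j)) = X := funext hK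
  exact ⟨_, nonempty_isColimit_quotient_cofan c K⟩

end HomotopyCategory

theorem CategoryTheory.ShortComplex.exact_iff_evaluation {J V : Type*} [Category* J] [Category* V]
    [Abelian V] (S : ShortComplex (J ⥤ V)) :
    S.Exact ↔ ∀ j, (S.map ((evaluation J V).obj j)).Exact := by
  simp only [ShortComplex.exact_iff_isZero_homology]
  rw [Functor.isZero_iff]
  exact forall_congr' fun j => (S.mapHomologyIso ((evaluation J V).obj j)).symm.isZero_iff

theorem HomologicalComplex.acyclic_coproduct {C : Type*} [Category* C] [Abelian C] {ι : Type*}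
    {c : ComplexShape ι} {J : Type*} [HasCoproductsOfShape J C]
    [HasExactColimitsOfShape (Discrete J) C] (K : J → HomologicalComplex C c)
    (hK : ∀ j, (K j).Acyclic) : (∐ K).Acyclic := by
  intro i
  -- The three terms of `∐ K` around `i` are colimits of the exact sequences given by the `K j`.
  let F : Discrete J ⥤ ShortComplex C :=
    Discrete.functor K ⋙ HomologicalComplex.shortComplexFunctor C c i
  let S : ShortComplex (Discrete J ⥤ C) := (ShortComplex.FunctorEquivalence.inverse _ C).obj F
  have hS : S.Exact := S.exact_iff_evaluation.2 fun j => hK j.as i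
  let hc := fun i => isColimitOfPreserves (HomologicalComplex.eval C c i) (coproductIsCoproduct K)
  exact colim.exact_mapShortComplex hS (hc (c.prev i)) (hc i) (hc (c.next i)) ((∐ K).d _ _)
    ((∐ K).d _ _) (fun j => (Sigma.ι K j.as).comm _ _) fun j => (Sigma.ι K j.as).comm _ _

namespace DerivedCategory

variable {C : Type*} [Category* C] [Abelian C] (J : Type*)
  [HasCoproductsOfShape J C] [HasExactColimitsOfShape (Discrete J) C]

instance : (HomotopyCategory.subcategoryAcyclic C).IsClosedUnderColimitsOfShape (Discrete J) where
  colimitsOfShape_le := by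
    rintro X ⟨p⟩
    choose K hK using fun j : J => HomotopyCategory.quotient_obj_surjective (p.diag.obj ⟨j⟩)
    have hA : ∀ j, (K j).Acyclic := fun j => by
      rw [← HomotopyCategory.quotient_obj_mem_subcategoryAcyclic_iff_acyclic, hK]
      exact p.prop_diag_obj _
    let e : Discrete.functor (fun j => (HomotopyCategory.quotient C _).obj (K j)) ≅ p.diag :=
      Discrete.natIso fun j => eqToIso (hK j.as)
    have h := (HomotopyCategory.nonempty_isColimit_quotient_cofan _ K).some
    refine ObjectProperty.prop_of_iso _ (IsColimit.coconePointsIsoOfNatIso h p.isColimit e) ?_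
    exact (HomotopyCategory.quotient_obj_mem_subcategoryAcyclic_iff_acyclic _).2
      (HomologicalComplex.acyclic_coproduct K hA)

theorem hasCoproductsOfShape [HasDerivedCategory.{w'} C] :
    HasCoproductsOfShape J (DerivedCategory C) := by
  have := (HomotopyCategory.subcategoryAcyclic C).trW_isStableUnderCoproductsOfShape J
  exact Localization.hasCoproductsOfShape Qh (HomotopyCategory.subcategoryAcyclic C).trW J

end DerivedCategory

/-! ### Adjoint exact functors on derived categories -/

namespace CategoryTheory

section Derived

variable {A B : Type*} [Category* A] [Category* B] {F : A ⥤ B} {H : B ⥤ A}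

/-- An adjunction between additive functors, applied termwise to complexes. -/
noncomputable def Adjunction.mapHomologicalComplex [Preadditive A] [Preadditive B] [F.Additive]
    [H.Additive] (adj : F ⊣ H) {ι : Type*} (c : ComplexShape ι) :
    F.mapHomologicalComplex c ⊣ H.mapHomologicalComplex c :=
  Adjunction.mkOfUnitCounit
    { unit :=
        { app K :=
            { f i := adj.unit.app (K.X i)
              comm' i j _ := (adj.unit.naturality (K.d i j)).symm }
          naturality _ _ f := by ext i; exact adj.unit.naturality (f.f i) }
      counit :=
        { app K :=
            { f i := adj.counit.app (K.X i)
              comm' i j _ := (adj.counit.naturality (K.d i j)).symm }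
          naturality _ _ f := by ext i; exact adj.counit.naturality (f.f i) }
      left_triangle := by
        ext K i
        exact (congrArg (_ ≫ ·) (Category.id_comp _)).trans (adj.left_triangle_components (K.X i))
      right_triangle := by
        ext K i
        exact (congrArg (_ ≫ ·) (Category.id_comp _)).trans
          (adj.right_triangle_components (K.X i)) }

variable [Abelian A] [Abelian B] [HasDerivedCategory.{w} A] [HasDerivedCategory.{w'} B]
  [F.Additive] [PreservesFiniteLimits F] [PreservesFiniteColimits F]
  [H.Additive] [PreservesFiniteLimits H] [PreservesFiniteColimits H]

/-- Adjoint exact functors induce adjoint functors on derived categories. -/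
noncomputable def Adjunction.mapDerivedCategory (adj : F ⊣ H) :
    F.mapDerivedCategory ⊣ H.mapDerivedCategory :=
  letI : CatCommSq (F.mapHomologicalComplex (ComplexShape.up ℤ)) DerivedCategory.Q
    DerivedCategory.Q F.mapDerivedCategory := ⟨F.mapDerivedCategoryFactors.symm⟩
  letI : CatCommSq (H.mapHomologicalComplex (ComplexShape.up ℤ)) DerivedCategory.Q
    DerivedCategory.Q H.mapDerivedCategory := ⟨H.mapDerivedCategoryFactors.symm⟩
  (adj.mapHomologicalComplex (ComplexShape.up ℤ)).localization
    DerivedCategory.Q (HomologicalComplex.quasiIso A _)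
    DerivedCategory.Q (HomologicalComplex.quasiIso B _) _ _

/-- A morphism of the derived category is, up to isomorphisms, the image of a morphism of complexes,
and a conservative exact functor detects quasi-isomorphisms. -/
instance [H.ReflectsIsomorphisms] : H.mapDerivedCategory.ReflectsIsomorphisms where
  reflects {X Y} f hf := by
    let eX := DerivedCategory.Q.objObjPreimageIso X
    let eY := DerivedCategory.Q.objObjPreimageIso Y
    obtain ⟨K, s, hs, g, hg⟩ := DerivedCategory.right_fac (eX.hom ≫ f ≫ eY.inv)
    have hg' : DerivedCategory.Q.map g = DerivedCategory.Q.map s ≫ eX.hom ≫ f ≫ eY.inv := by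
      rw [hg, IsIso.hom_inv_id_assoc]
    have hf' : f = eX.inv ≫ inv (DerivedCategory.Q.map s) ≫ DerivedCategory.Q.map g ≫ eY.hom := by
      simp [hg']
    have h1 : IsIso (H.mapDerivedCategory.map (DerivedCategory.Q.map g)) := by
      rw [hg']
      simp only [Functor.map_comp]
      infer_instance
    have h2 : IsIso (DerivedCategory.Q.map ((H.mapHomologicalComplex (ComplexShape.up ℤ)).map g)) :=
      (NatIso.isIso_map_iff H.mapDerivedCategoryFactors g).1 h1
    rw [DerivedCategory.isIso_Q_map_iff_quasiIso,
      HomologicalComplex.quasiIso_map_iff_of_preservesHomology] at h2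
    rw [hf']
    infer_instance

end Derived

end CategoryTheory

/-! ### Transfer of injective generation -/

section Transfer

variable {S T : Type*} [Category* S] [HasZeroObject S] [HasShift S ℤ] [Preadditive S]
  [∀ n : ℤ, (shiftFunctor S n).Additive] [Pretriangulated S]
  [Category* T] [HasZeroObject T] [HasShift T ℤ] [Preadditive T]
  [∀ n : ℤ, (shiftFunctor T n).Additive] [Pretriangulated T]

theorem IsLocalizing.inverseImage {P : ObjectProperty T} (hP : IsLocalizing.{w} P) (F : S ⥤ T)
    [F.CommShift ℤ] [F.IsTriangulated]
    (hF : ∀ ι : Type w, PreservesColimitsOfShape (Discrete ι) F) :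
    IsLocalizing.{w} (P.inverseImage F) := by
  have := hP.isTriangulated
  have := hP.isClosedUnderIsomorphisms
  exact ⟨inferInstance, inferInstance, fun ι =>
    have := hP.isClosedUnderCoproducts ι
    have := hF ι
    inferInstance⟩

end Transfer

/-- Injective generation passes from `A` to `B` along an exact functor `F : A ⥤ B` which is both a
left and a right adjoint of a conservative functor `H : B ⥤ A`. -/
theorem Loc_injective_eq_top_of_adjunctions {A B : Type*} [Category* A] [Category* B] [Abelian A]
    [Abelian B] [HasDerivedCategory.{w'} A] [HasDerivedCategory.{w} B] [HasCoproductsOfShape ℕ B]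
    [HasExactColimitsOfShape (Discrete ℕ) B] {F : A ⥤ B} {H : B ⥤ A} [F.Additive] [H.Additive]
    [H.ReflectsIsomorphisms] (adj : F ⊣ H) (adj' : H ⊣ F)
    (hA : Loc.{v} (inDegreeZero fun I : A => Injective I) = ⊤) :
    Loc.{v} (inDegreeZero fun I : B => Injective I) = ⊤ := by
  have : PreservesFiniteLimits F := ⟨fun _ _ _ => adj'.rightAdjoint_preservesLimits.1⟩
  have : PreservesFiniteColimits F := ⟨fun _ _ _ => adj.leftAdjoint_preservesColimits.1⟩
  have : PreservesFiniteLimits H := ⟨fun _ _ _ => adj.rightAdjoint_preservesLimits.1⟩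
  have : PreservesFiniteColimits H := ⟨fun _ _ _ => adj'.leftAdjoint_preservesColimits.1⟩
  have : PreservesColimitsOfShape (Discrete ℕ) H.mapDerivedCategory :=
    adj'.mapDerivedCategory.leftAdjoint_preservesColimits.1
  have := DerivedCategory.hasCoproductsOfShape (C := B) ℕ
  have hB := isLocalizing_Loc.{v} (inDegreeZero fun I : B => Injective I)
  have hFB := hB.inverseImage F.mapDerivedCategory
    fun _ => adj.mapDerivedCategory.leftAdjoint_preservesColimits.1
  have hle := Loc_le (S := inDegreeZero fun I : A => Injective I) hFB (by
    rintro _ ⟨I, hI, rfl⟩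
    have := hB.isClosedUnderIsomorphisms
    exact (Loc.{v} (inDegreeZero fun I : B => Injective I)).prop_of_iso
      (F.mapDerivedCategorySingleFunctor 0 |>.app I).symm
      (le_Loc _ _ ⟨F.obj I, Injective.injective_of_adjoint adj' I, rfl⟩))
  refine hB.eq_top_of_adjunction adj.mapDerivedCategory fun X => hle X ?_
  rw [hA]
  trivial

/-! ### Modules over a ring graded by a finite group -/

namespace GrMod

section Homogeneous

variable {Γ : Type w} [AddCommGroup Γ] [DecidableEq Γ] {R : Type u} [Ring R]

/-- An additive map between right modules over a graded ring is linear if it commutes with the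
action of homogeneous elements. -/
def linearMapOfHomogeneous (𝓡 : Γ → AddSubgroup R) [GradedRing 𝓡] {M N : Type*} [AddCommGroup M]
    [Module Rᵐᵒᵖ M] [AddCommGroup N] [Module Rᵐᵒᵖ N] (f : M →+ N)
    (h : ∀ (δ : Γ), ∀ r ∈ 𝓡 δ, ∀ m, f (MulOpposite.op r • m) = MulOpposite.op r • f m) :
    M →ₗ[Rᵐᵒᵖ] N where
  toFun := f
  map_add' := f.map_add
  map_smul' a m := by
    obtain ⟨r, rfl⟩ := MulOpposite.op_surjective a
    induction r using DirectSum.Decomposition.inductionOn 𝓡 with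
    | zero => simp
    | homogeneous r => exact h _ _ r.2 m
    | add r s hr hs => simp_all [add_smul]

variable {𝓡 : Γ → AddSubgroup R}

theorem proj_smul (M : GrMod.{w, v, u} 𝓡) {δ : Γ} {r : R} (hr : r ∈ 𝓡 δ) (γ : Γ) (m : M.toMod) :
    M.proj γ (MulOpposite.op r • m) = MulOpposite.op r • M.proj (γ - δ) m := by
  have key : ∀ ε, ∀ m ∈ M.gr ε,
      M.proj γ (MulOpposite.op r • m) = MulOpposite.op r • M.proj (γ - δ) m := by
    intro ε m hm
    have hrm := M.smul_mem hm hr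
    by_cases h : ε + δ = γ
    · obtain rfl : ε = γ - δ := eq_sub_of_add_eq h
      rw [h] at hrm
      rw [projOf_same _ hm, projOf_same _ hrm]
    · rw [projOf_ne _ h hrm, projOf_ne _ (fun h' => h (by rw [h', sub_add_cancel])) hm, smul_zero]
  obtain ⟨s, hs⟩ := exists_sum_projOf M.isInternal m
  rw [hs]
  simp only [map_sum, Finset.smul_sum]
  exact Finset.sum_congr rfl fun ε _ => key ε _ (projOf_mem _ _ _)

theorem sum_proj [Fintype Γ] (M : GrMod.{w, v, u} 𝓡) (m : M.toMod) : ∑ γ, M.proj γ m = m := by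
  classical
  obtain ⟨x, rfl⟩ := M.isInternal.2 m
  simp only [projOf_coe]
  rw [DirectSum.coeAddMonoidHom_eq_dfinsuppSum, DFinsupp.sum]
  refine (Finset.sum_subset (Finset.subset_univ _) fun γ _ hγ => ?_).symm
  simpa using hγ

end Homogeneous

/-! ### The coinduced graded module -/

/-- Functions `Γ → M`, the underlying group of the graded module coinduced from `M`. They are
encoded as functions on `Fin (card Γ)`, so that they lie in the universe of `M`. The grading is a
parameter because it determines the module structure. -/
def Coind {Γ : Type w} [Fintype Γ] {R : Type u} [Ring R] (_ : Γ → AddSubgroup R)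
    (M : Type v) : Type v :=
  Fin (Fintype.card Γ) → M

namespace Coind

variable {Γ : Type w} [Fintype Γ] {R : Type u} [Ring R] {𝓡 : Γ → AddSubgroup R} {M : Type v}
  [AddCommGroup M]

instance : AddCommGroup (Coind 𝓡 M) := inferInstanceAs (AddCommGroup (Fin (Fintype.card Γ) → M))

/-- The value of a function `Γ → M` at `γ`. -/
noncomputable def coeff (γ : Γ) : Coind 𝓡 M →+ M :=
  Pi.evalAddMonoidHom (fun _ : Fin (Fintype.card Γ) => M) (Fintype.equivFin Γ γ)

/-- The element of `Coind 𝓡 M` given by a function `Γ → M`. -/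
noncomputable def mk (𝓡 : Γ → AddSubgroup R) (f : Γ → M) : Coind 𝓡 M :=
  fun i => f ((Fintype.equivFin Γ).symm i)

@[simp]
theorem coeff_mk (f : Γ → M) (γ : Γ) : coeff γ (mk 𝓡 f) = f γ :=
  congrArg f ((Fintype.equivFin Γ).symm_apply_apply γ)

@[ext]
theorem ext {f g : Coind 𝓡 M} (h : ∀ γ, coeff γ f = coeff γ g) : f = g := by
  funext i
  obtain ⟨γ, rfl⟩ := (Fintype.equivFin Γ).surjective i
  exact h γ

/-- The additive map to `Coind 𝓡 M` with given coefficients. -/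
noncomputable def lift {N : Type*} [AddCommGroup N] (𝓡 : Γ → AddSubgroup R) (f : Γ → N →+ M) :
    N →+ Coind 𝓡 M where
  toFun n := mk 𝓡 fun γ => f γ n
  map_zero' := by ext; simp
  map_add' _ _ := by ext; simp

@[simp]
theorem coeff_lift {N : Type*} [AddCommGroup N] (f : Γ → N →+ M) (n : N) (γ : Γ) :
    coeff γ (lift 𝓡 f n) = f γ n :=
  coeff_mk (fun γ => f γ n) γ

variable [AddCommGroup Γ] [DecidableEq Γ] [GradedRing 𝓡] [Module Rᵐᵒᵖ M]

/-- The action of `r` is the sum of those of its homogeneous components, the component of degree `δ`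
acting by `(f r) (γ) = f (γ - δ) r`. -/
noncomputable instance : SMul Rᵐᵒᵖ (Coind 𝓡 M) where
  smul a f := mk 𝓡 fun γ =>
    ∑ δ, MulOpposite.op (DirectSum.decompose 𝓡 a.unop δ : R) • coeff (γ - δ) f

theorem coeff_smul (a : Rᵐᵒᵖ) (f : Coind 𝓡 M) (γ : Γ) : coeff γ (a • f) =
    ∑ δ, MulOpposite.op (DirectSum.decompose 𝓡 a.unop δ : R) • coeff (γ - δ) f :=
  coeff_mk _ _

/-- Homogeneous elements of degree `δ` act by shifting the coefficients by `δ`. -/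
theorem coeff_smul_of_mem {δ : Γ} {r : R} (hr : r ∈ 𝓡 δ) (f : Coind 𝓡 M) (γ : Γ) :
    coeff γ (MulOpposite.op r • f) = MulOpposite.op r • coeff (γ - δ) f := by
  rw [coeff_smul, Finset.sum_eq_single δ]
  · rw [MulOpposite.unop_op, DirectSum.decompose_of_mem_same 𝓡 hr]
  · intro ε _ hε
    rw [MulOpposite.unop_op, DirectSum.decompose_of_mem_ne 𝓡 hr hε.symm, MulOpposite.op_zero,
      zero_smul]
  · simp

theorem smul_add' (a : Rᵐᵒᵖ) (f g : Coind 𝓡 M) : a • (f + g) = a • f + a • g := by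
  ext γ
  simp [coeff_smul, Finset.sum_add_distrib]

theorem add_smul' (a b : Rᵐᵒᵖ) (f : Coind 𝓡 M) : (a + b) • f = a • f + b • f := by
  ext γ
  simp [coeff_smul, add_smul, Finset.sum_add_distrib]

theorem zero_smul' (f : Coind 𝓡 M) : (0 : Rᵐᵒᵖ) • f = 0 := by
  ext γ
  simp [coeff_smul]

theorem mul_smul' (a b : Rᵐᵒᵖ) (f : Coind 𝓡 M) : (a * b) • f = a • b • f := by
  obtain ⟨r, rfl⟩ := MulOpposite.op_surjective a
  obtain ⟨s, rfl⟩ := MulOpposite.op_surjective b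
  induction r using DirectSum.Decomposition.inductionOn 𝓡 with
  | zero => simp [zero_smul']
  | add r r' hr hr' => simp only [MulOpposite.op_add, add_mul, add_smul', hr, hr']
  | @homogeneous δ r =>
    induction s using DirectSum.Decomposition.inductionOn 𝓡 with
    | zero => rw [MulOpposite.op_zero, mul_zero, zero_smul']; ext γ; simp [coeff_smul]
    | add s s' hs hs' => simp only [MulOpposite.op_add, mul_add, add_smul', hs, hs', smul_add']
    | @homogeneous ε s =>
      ext γ
      rw [← MulOpposite.op_mul, coeff_smul_of_mem (SetLike.mul_mem_graded s.2 r.2),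
        coeff_smul_of_mem r.2, coeff_smul_of_mem s.2, MulOpposite.op_mul, mul_smul,
        sub_sub, add_comm ε δ]

noncomputable instance : Module Rᵐᵒᵖ (Coind 𝓡 M) where
  one_smul f := by
    ext γ
    rw [← MulOpposite.op_one, coeff_smul_of_mem SetLike.GradedOne.one_mem, sub_zero,
      MulOpposite.op_one, one_smul]
  mul_smul := mul_smul'
  smul_zero a := by ext γ; simp [coeff_smul]
  smul_add := smul_add'
  add_smul := add_smul'
  zero_smul := zero_smul'

/-- The linear map to `Coind 𝓡 M` with given coefficients. -/
noncomputable def liftLinear {N : Type*} [AddCommGroup N] [Module Rᵐᵒᵖ N]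
    (𝓡 : Γ → AddSubgroup R) [GradedRing 𝓡] (f : Γ → N →+ M)
    (hf : ∀ (δ : Γ), ∀ r ∈ 𝓡 δ, ∀ γ n,
      f γ (MulOpposite.op r • n) = MulOpposite.op r • f (γ - δ) n) : N →ₗ[Rᵐᵒᵖ] Coind 𝓡 M :=
  linearMapOfHomogeneous 𝓡 (lift 𝓡 f) fun δ r hr n => by
    ext γ
    rw [coeff_smul_of_mem hr, coeff_lift, coeff_lift, hf δ r hr]

end Coind

section Functors

variable {Γ : Type w} [AddCommGroup Γ] [DecidableEq Γ] {R : Type u} [Ring R]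
  [Fintype Γ] (𝓡 : Γ → AddSubgroup R) [GradedRing 𝓡]

/-- The graded module coinduced from `M`: its component of degree `γ` consists of the functions
`Γ → M` supported at `γ`. -/
noncomputable def coindObj (M : ModuleCat.{v} Rᵐᵒᵖ) : GrMod.{w, v, u} 𝓡 where
  toMod := ModuleCat.of Rᵐᵒᵖ (Coind 𝓡 M)
  gr γ := ⨅ δ ∈ ({γ}ᶜ : Set Γ), (Coind.coeff δ : Coind 𝓡 M →+ M).ker
  isInternal := by
    refine isInternal_of_proj (M := Coind 𝓡 M)
      (fun γ => Coind.lift 𝓡 fun δ => if δ = γ then Coind.coeff δ else 0) ?_ ?_ ?_ ?_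
    · intro γ m hm
      simp only [AddSubgroup.mem_iInf] at hm
      ext δ
      by_cases h : δ = γ
      · simp [h]
      · simpa [h] using (hm δ h).symm
    · intro γ δ h m hm
      simp only [AddSubgroup.mem_iInf] at hm
      ext ε
      by_cases h' : ε = δ
      · subst h'
        simpa using hm ε (Ne.symm h)
      · simp [h']
    · intro γ m
      simp only [AddSubgroup.mem_iInf]
      intro δ hδ
      have hδ' : δ ≠ γ := hδ
      simp [AddMonoidHom.mem_ker, hδ']
    · intro m
      refine ⟨Finset.univ, ?_⟩
      ext δ
      simp only [map_sum, Coind.coeff_lift]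
      rw [Finset.sum_eq_single δ] <;> simp +contextual [eq_comm]
  smul_mem {γ δ m r} hm hr := by
    simp only [AddSubgroup.mem_iInf] at hm ⊢
    intro ε hε
    have h : ε - δ ≠ γ := fun h => hε (sub_eq_iff_eq_add.1 h)
    have h0 : Coind.coeff (ε - δ) (𝓡 := 𝓡) (M := M) m = 0 := hm _ h
    refine (Coind.coeff_smul_of_mem hr (M := M) m ε).trans ?_
    rw [h0, smul_zero]

theorem mem_coindObj_gr {M : ModuleCat.{v} Rᵐᵒᵖ} {γ : Γ} {f : Coind 𝓡 M} :
    f ∈ (coindObj 𝓡 M).gr γ ↔ ∀ δ ≠ γ, Coind.coeff δ f = 0 := by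
  change f ∈ (⨅ δ ∈ ({γ}ᶜ : Set Γ), (Coind.coeff δ : Coind 𝓡 M →+ M).ker : AddSubgroup _) ↔ _
  simp only [AddSubgroup.mem_iInf]
  rfl

/-- The forgetful functor from graded modules to modules. -/
def forgetGrading (𝓡 : Γ → AddSubgroup R) : GrMod.{w, v, u} 𝓡 ⥤ ModuleCat.{v} Rᵐᵒᵖ where
  obj M := M.toMod
  map f := f.hom

/-- The linear map between coinduced modules obtained by applying `φ` to the coefficients. -/
noncomputable def Coind.map {M N : Type*} [AddCommGroup M] [Module Rᵐᵒᵖ M] [AddCommGroup N]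
    [Module Rᵐᵒᵖ N] (φ : M →ₗ[Rᵐᵒᵖ] N) : Coind 𝓡 M →ₗ[Rᵐᵒᵖ] Coind 𝓡 N :=
  Coind.liftLinear 𝓡 (fun γ => φ.toAddMonoidHom.comp (Coind.coeff γ)) fun _ _ hr γ m => by
    simp [Coind.coeff_smul_of_mem hr]

@[simp]
theorem Coind.coeff_map {M N : Type*} [AddCommGroup M] [Module Rᵐᵒᵖ M] [AddCommGroup N]
    [Module Rᵐᵒᵖ N] (φ : M →ₗ[Rᵐᵒᵖ] N) (γ : Γ) (m : Coind 𝓡 M) :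
    Coind.coeff γ (Coind.map 𝓡 φ m) = φ (Coind.coeff γ m) :=
  Coind.coeff_lift (fun γ => φ.toAddMonoidHom.comp (Coind.coeff γ)) m γ

/-- The coinduction functor from modules to graded modules. -/
noncomputable def coind : ModuleCat.{v} Rᵐᵒᵖ ⥤ GrMod.{w, v, u} 𝓡 where
  obj M := coindObj 𝓡 M
  map {M N} φ :=
    { hom := ModuleCat.ofHom (Coind.map 𝓡 φ.hom)
      map_mem := fun {γ m} hm => (mem_coindObj_gr 𝓡).2 fun δ hδ => by
        have h : Coind.coeff δ (𝓡 := 𝓡) (M := M) m = 0 := (mem_coindObj_gr 𝓡).1 hm δ hδ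
        exact (Coind.coeff_map 𝓡 φ.hom δ m).trans ((congrArg φ h).trans (map_zero φ.hom)) }
  map_id M := by
    ext m
    exact Coind.ext fun γ => Coind.coeff_map 𝓡 _ γ m
  map_comp {M N K} f g := by
    ext m
    refine Coind.ext fun γ => (Coind.coeff_map 𝓡 _ γ m).trans (Eq.symm ?_)
    exact (Coind.coeff_map 𝓡 g.hom γ _).trans (congrArg g (Coind.coeff_map 𝓡 f.hom γ m))

instance : (forgetGrading.{w, v, u} 𝓡).Additive where

instance : (forgetGrading.{w, v, u} 𝓡).Faithful where
  map_injective h := hom_ext h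

instance : (coind.{w, v, u} 𝓡).Additive where
  map_add {M N f g} := by
    ext m
    refine Coind.ext fun γ => (Coind.coeff_map 𝓡 _ γ m).trans (Eq.symm ?_)
    refine (map_add (Coind.coeff γ) (Coind.map 𝓡 f.hom m) (Coind.map 𝓡 g.hom m)).trans ?_
    exact congrArg₂ (· + ·) (Coind.coeff_map 𝓡 f.hom γ m) (Coind.coeff_map 𝓡 g.hom γ m)

/-- The linear map from a graded module `N` to its coinduced module with coefficients the
homogeneous components. -/
noncomputable def components (N : GrMod.{w, v, u} 𝓡) : N.toMod →ₗ[Rᵐᵒᵖ] Coind 𝓡 N.toMod :=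
  Coind.liftLinear 𝓡 N.proj fun _ _ hr γ n => N.proj_smul hr γ n

theorem coeff_components (N : GrMod.{w, v, u} 𝓡) (γ : Γ) (n : N.toMod) :
    Coind.coeff γ (components 𝓡 N n) = N.proj γ n :=
  Coind.coeff_lift N.proj n γ

/-- Summing the coefficients. -/
noncomputable def sumCoeff (M : ModuleCat.{v} Rᵐᵒᵖ) : Coind 𝓡 M →ₗ[Rᵐᵒᵖ] M :=
  linearMapOfHomogeneous 𝓡 (∑ γ, Coind.coeff γ) fun δ r hr m => by
    simp only [AddMonoidHom.finsetSum_apply, Coind.coeff_smul_of_mem hr, Finset.smul_sum]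
    exact Fintype.sum_equiv (Equiv.subRight δ) _ _ fun _ => rfl

/-- The diagonal map, sending `m` to the constant function with value `m`. -/
noncomputable def diag (M : ModuleCat.{v} Rᵐᵒᵖ) : M →ₗ[Rᵐᵒᵖ] Coind 𝓡 M :=
  Coind.liftLinear 𝓡 (fun _ => AddMonoidHom.id M) fun _ _ _ _ _ => rfl

/-- Summing, over all degrees `γ`, the homogeneous components of degree `γ` of the values at `γ`. -/
noncomputable def sumProjCoeff (N : GrMod.{w, v, u} 𝓡) : Coind 𝓡 N.toMod →ₗ[Rᵐᵒᵖ] N.toMod :=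
  linearMapOfHomogeneous 𝓡 (∑ γ, (N.proj γ).comp (Coind.coeff γ)) fun δ r hr m => by
    simp only [AddMonoidHom.finsetSum_apply, AddMonoidHom.comp_apply, Coind.coeff_smul_of_mem hr,
      Finset.smul_sum, N.proj_smul hr]
    exact Fintype.sum_equiv (Equiv.subRight δ) _ _ fun _ => rfl

theorem coeff_diag (M : ModuleCat.{v} Rᵐᵒᵖ) (γ : Γ) (m : M) :
    Coind.coeff γ (diag 𝓡 M m) = m :=
  Coind.coeff_lift (fun _ => AddMonoidHom.id M) m γ

/-- The projections of the coinduced graded module, as maps on functions `Γ → M`. -/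
noncomputable def coindProj (M : ModuleCat.{v} Rᵐᵒᵖ) (γ : Γ) : Coind 𝓡 M →+ Coind 𝓡 M :=
  (coindObj 𝓡 M).proj γ

theorem coeff_coindProj (M : ModuleCat.{v} Rᵐᵒᵖ) (γ : Γ) (f : Coind 𝓡 M) (δ : Γ) :
    Coind.coeff δ (coindProj 𝓡 M γ f) = if δ = γ then Coind.coeff δ f else 0 := by
  have hne : ∀ γ' ≠ δ, Coind.coeff δ (coindProj 𝓡 M γ' f) = 0 :=
    fun γ' hγ' => (mem_coindObj_gr 𝓡).1 (projOf_mem _ γ' f) δ hγ'.symm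
  split_ifs with hδ
  · subst hδ
    have h : ∑ γ', coindProj 𝓡 M γ' f = f := (coindObj 𝓡 M).sum_proj f
    have h' := congrArg (Coind.coeff δ) h
    rwa [map_sum, Finset.sum_eq_single δ (fun γ' _ => hne γ') (by simp)] at h'
  · exact hne γ (Ne.symm hδ)

theorem sumCoeff_apply (M : ModuleCat.{v} Rᵐᵒᵖ) (m : Coind 𝓡 M) :
    sumCoeff 𝓡 M m = ∑ γ, Coind.coeff γ m :=
  AddMonoidHom.finsetSum_apply _ _ _

theorem sumProjCoeff_apply (N : GrMod.{w, v, u} 𝓡) (m : Coind 𝓡 N.toMod) :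
    sumProjCoeff 𝓡 N m = ∑ γ, N.proj γ (Coind.coeff γ m) :=
  AddMonoidHom.finsetSum_apply _ _ _

theorem sum_coindProj_coeff_map_diag (M : ModuleCat.{v} Rᵐᵒᵖ) (f : Coind 𝓡 M) :
    ∑ γ, coindProj 𝓡 M γ (Coind.coeff γ (Coind.map 𝓡 (diag 𝓡 M) f)) = f := by
  refine Coind.ext fun δ => ?_
  have h : ∀ γ, Coind.coeff δ (coindProj 𝓡 M γ (Coind.coeff γ (Coind.map 𝓡 (diag 𝓡 M) f))) =
      if δ = γ then Coind.coeff γ f else 0 := fun γ => by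
    rw [coeff_coindProj]
    exact congrArg (if δ = γ then · else 0) ((congrArg (Coind.coeff δ)
      (Coind.coeff_map 𝓡 (diag 𝓡 M) γ f)).trans (coeff_diag 𝓡 M δ _))
  rw [map_sum, Finset.sum_congr rfl fun γ _ => h γ, Finset.sum_ite_eq,
    if_pos (Finset.mem_univ _)]

/-! ### The two adjunctions -/

/-- Coinduction is right adjoint to forgetting the grading. The unit takes homogeneous
components, the counit sums the values of a function. -/
noncomputable def forgetAdjCoind : forgetGrading.{w, v, u} 𝓡 ⊣ coind 𝓡 :=
  Adjunction.mkOfUnitCounit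
    { unit :=
        { app N :=
            { hom := ModuleCat.ofHom (components 𝓡 N)
              map_mem hm := (mem_coindObj_gr 𝓡).2 fun δ hδ =>
                (coeff_components 𝓡 N δ _).trans (projOf_ne _ hδ.symm hm) }
          naturality N N' f := by
            ext n
            refine Coind.ext fun γ => (coeff_components 𝓡 N' γ (f.hom n)).trans (Eq.symm ?_)
            refine (Coind.coeff_map 𝓡 f.hom.hom γ (components 𝓡 N n)).trans ?_
            exact (congrArg f.hom (coeff_components 𝓡 N γ n)).trans (hom_proj f γ n) }
      counit :=
        { app M := ModuleCat.ofHom (sumCoeff 𝓡 M)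
          naturality M M' f := by
            ext m
            refine (sumCoeff_apply 𝓡 M' (Coind.map 𝓡 f.hom m)).trans ?_
            refine Eq.trans ?_ (congrArg f (sumCoeff_apply 𝓡 M m)).symm
            rw [map_sum]
            exact Finset.sum_congr rfl fun γ _ => Coind.coeff_map 𝓡 f.hom γ m }
      left_triangle := by
        ext N n
        refine (sumCoeff_apply 𝓡 N.toMod (components 𝓡 N n)).trans ?_
        exact (Finset.sum_congr rfl fun γ _ => coeff_components 𝓡 N γ n).trans (N.sum_proj n)
      right_triangle := by
        ext M m
        refine Coind.ext fun γ =>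
          (Coind.coeff_map 𝓡 (sumCoeff 𝓡 M) γ (components 𝓡 (coindObj 𝓡 M) m)).trans ?_
        refine (congrArg (sumCoeff 𝓡 M) (coeff_components 𝓡 (coindObj 𝓡 M) γ m)).trans ?_
        refine (sumCoeff_apply 𝓡 M (coindProj 𝓡 M γ m)).trans ?_
        refine (Finset.sum_congr rfl fun δ _ => coeff_coindProj 𝓡 M γ m δ).trans ?_
        rw [Finset.sum_ite_eq', if_pos (Finset.mem_univ _)]
        rfl }

/-- Since `Γ` is finite, coinduction is also left adjoint to forgetting the grading. The unit takes
constant functions, the counit sums the components of degree `γ` of the values at `γ`. -/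
noncomputable def coindAdjForget : coind.{w, v, u} 𝓡 ⊣ forgetGrading 𝓡 :=
  Adjunction.mkOfUnitCounit
    { unit :=
        { app M := ModuleCat.ofHom (diag 𝓡 M)
          naturality M M' f := by
            ext m
            refine Coind.ext fun γ => (coeff_diag 𝓡 M' γ (f m)).trans (Eq.symm ?_)
            exact (Coind.coeff_map 𝓡 f.hom γ (diag 𝓡 M m)).trans (congrArg f (coeff_diag 𝓡 M γ m)) }
      counit :=
        { app N :=
            { hom := ModuleCat.ofHom (sumProjCoeff 𝓡 N)
              map_mem := fun {γ m} hm => by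
                refine (congrArg (· ∈ N.gr γ) (sumProjCoeff_apply 𝓡 N m)).mpr ?_
                rw [Finset.sum_eq_single γ]
                · exact projOf_mem _ _ _
                · intro δ _ hδ
                  have h : Coind.coeff δ (𝓡 := 𝓡) (M := N.toMod) m = 0 :=
                    (mem_coindObj_gr 𝓡).1 hm δ hδ
                  rw [h, map_zero]
                · simp }
          naturality N N' f := by
            ext m
            refine (sumProjCoeff_apply 𝓡 N' (Coind.map 𝓡 f.hom.hom m)).trans ?_
            refine Eq.trans ?_ (congrArg f.hom (sumProjCoeff_apply 𝓡 N m)).symm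
            rw [map_sum]
            refine Finset.sum_congr rfl fun γ _ => ?_
            refine Eq.trans ?_ (hom_proj f γ _).symm
            exact congrArg (N'.proj γ) (Coind.coeff_map 𝓡 f.hom.hom γ m) }
      left_triangle := by
        ext M m
        exact (sumProjCoeff_apply 𝓡 (coindObj 𝓡 M) (Coind.map 𝓡 (diag 𝓡 M) m)).trans
          (sum_coindProj_coeff_map_diag 𝓡 M m)
      right_triangle := by
        ext N n
        refine (sumProjCoeff_apply 𝓡 N (diag 𝓡 N.toMod n)).trans ?_
        refine (Finset.sum_congr rfl fun γ _ => ?_).trans (N.sum_proj n)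
        exact congrArg (N.proj γ) (coeff_diag 𝓡 N.toMod γ n) }

end Functors

end GrMod

/-! ### Exactness properties of graded modules -/

namespace GrMod

variable {Γ : Type w} [AddCommGroup Γ] [DecidableEq Γ] [Fintype Γ] {R : Type u} [Ring R]
  (𝓡 : Γ → AddSubgroup R) [GradedRing 𝓡]

instance : (forgetGrading.{w, v, u} 𝓡).IsLeftAdjoint := (forgetAdjCoind 𝓡).isLeftAdjoint

instance : (forgetGrading.{w, v, u} 𝓡).IsRightAdjoint := (coindAdjForget 𝓡).isRightAdjoint

instance : (coind.{w, v, u} 𝓡).Faithful where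
  map_injective {M N f g} h := by
    ext m
    have h1 : Coind.map 𝓡 f.hom (diag 𝓡 M m) = Coind.map 𝓡 g.hom (diag 𝓡 M m) :=
      congrArg (fun φ : (coind 𝓡).obj M ⟶ (coind 𝓡).obj N => φ.hom (diag 𝓡 M m)) h
    have h2 := congrArg (Coind.coeff (0 : Γ)) h1
    rwa [Coind.coeff_map, Coind.coeff_map, coeff_diag] at h2

instance : Comonad.PreservesLimitOfIsCoreflexivePair (forgetGrading.{w, v, u} 𝓡) :=
  ⟨fun _ _ _ => inferInstance⟩

/-- As an exact conservative left adjoint, the forgetful functor is comonadic; in particular it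
creates colimits. -/
noncomputable instance : ComonadicLeftAdjoint (forgetGrading.{w, v, u} 𝓡) :=
  Comonad.comonadicOfHasPreservesCoreflexiveEqualizersOfReflectsIsomorphisms (forgetAdjCoind 𝓡)

variable (J : Type)

instance [HasCoproductsOfShape J (ModuleCat.{v} Rᵐᵒᵖ)] :
    HasCoproductsOfShape J (GrMod.{w, v, u} 𝓡) :=
  have := comonadicCreatesColimits.{0, 0} (forgetGrading.{w, v, u} 𝓡)
  hasColimitsOfShape_of_hasColimitsOfShape_createsColimitsOfShape (forgetGrading.{w, v, u} 𝓡)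

instance [HasCoproductsOfShape J (ModuleCat.{v} Rᵐᵒᵖ)]
    [HasExactColimitsOfShape (Discrete J) (ModuleCat.{v} Rᵐᵒᵖ)] :
    HasExactColimitsOfShape (Discrete J) (GrMod.{w, v, u} 𝓡) :=
  HasExactColimitsOfShape.domain_of_functor (Discrete J) (forgetGrading.{w, v, u} 𝓡)

instance : HasExactColimitsOfShape (Discrete ℕ) (ModuleCat.{u} Rᵐᵒᵖ) :=
  AB4OfSize.ofShape ℕ

end GrMod

theorem mainTheorem8 {Γ : Type w} [AddCommGroup Γ] [Finite Γ] [DecidableEq Γ]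
    {R : Type u} [Ring R] (𝓡 : Γ → AddSubgroup R) [GradedRing 𝓡]
    [HasDerivedCategory.{v} (ModuleCat.{u} Rᵐᵒᵖ)]
    [HasDerivedCategory.{w'} (GrMod.{w, u, u} 𝓡)] :
    GradedInjectivesGenerate 𝓡 ↔ InjectivesGenerate R := by
  have := Fintype.ofFinite Γ
  exact ⟨Loc_injective_eq_top_of_adjunctions (GrMod.forgetAdjCoind 𝓡) (GrMod.coindAdjForget 𝓡),
    Loc_injective_eq_top_of_adjunctions (GrMod.coindAdjForget 𝓡) (GrMod.forgetAdjCoind 𝓡)⟩
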